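/- Let $g:\mathbb{R}^m\to\mathbb{R}\cup\{\infty\}$ be a convex function, let $C_g$ be the interior of its effective domain $\{t: g(t)<\infty\}$, let $E$ be a real $m\times n$ matrix with no zero column, let $S\subseteq\{1,\dots,n\}$, $S^c=\{1,\dots,n\}\setminus S$, and let $\lambda>0$. Put $$\mathcal{X}=\{x\in\mathbb{R}^n:\ x_i\ge 0\ \text{for every } i\in S^c\},\qquad f_1(x)=g(Ex)+\lambda\sum_{i\in S}|x_i| .$$ Assume: (A1) $C_g\neq\emptyset$. (A2) $g$ is strictly convex and twice continuously differentiable on $C_g$. (A3) Either $g(t)\to\infty$ as $t\in C_g$ approaches any boundary point of $C_g$, or $|S|=n$ and $g$ is non-negative with $C_g=\mathbb{R}^m$. (A4) The Hessian $\nabla^2 g(t)$ is positive definite for every $t\in C_g$. (A5) The set of minimizers of $f_1$ over $\mathcal{X}$ is non-empty. Let $x^0\in\mathcal{X}$ with $f_1(x^0)<\infty$. Cyclic coordinatewise minimization started at $x^0$ produces $x^r$, $r\ge 0$, as follows: set $x^{r,0}=x^r$; for $i=1,2,\dots,n$ let $$x^{r,i}=\operatorname{arg\,min}\{f_1(x):\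 x\in\mathcal{X},\ x_j=x^{r,i-1}_j\ \text{for all } j\ne i\};$$ set $x^{r+1}=x^{r,n}$. Then there is exactly one sequence $\{x^r\}_{r\ge0}$ generated in this way from $x^0$, and it converges to a point $x^*\in\mathcal{X}$ such that $f_1(x^*)\le f_1(x)$ for every $x\in\mathcal{X}$. -/

import Mathlib

open Filter Topology

/-- The effective domain `{t : g t < ∞}` of an extended-real-valued function on `ℝ^m`. -/
def effDom {m : ℕ} (g : (Fin m → ℝ) → EReal) : Set (Fin m → ℝ) :=
  {t | g t < ⊤}

/-- `C_g`, the interior of the effective domain of `g`. -/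
def domInterior {m : ℕ} (g : (Fin m → ℝ) → EReal) : Set (Fin m → ℝ) :=
  interior (effDom g)

/-- The real values of `g`; they carry the information of `g` on its effective domain, and are only
used there. -/
noncomputable def finitePart {m : ℕ} (g : (Fin m → ℝ) → EReal) : (Fin m → ℝ) → ℝ :=
  fun t => (g t).toReal

/-- The second derivative `vᵀ ∇²g(t) v` of `g` at `t` in the direction `v`. -/
noncomputable def hessianForm {m : ℕ} (g : (Fin m → ℝ) → EReal) (t v : Fin m → ℝ) : ℝ :=
  fderiv ℝ (fderiv ℝ (finitePart g)) t v v

/-- The feasible set `{x ∈ ℝ^n : x_i ≥ 0 for every i ∉ S}`. -/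
def feasibleSet {n : ℕ} (S : Finset (Fin n)) : Set (Fin n → ℝ) :=
  {x | ∀ i, i ∉ S → 0 ≤ x i}

/-- The objective `f₁(x) = g(Ex) + lam * ∑_{i ∈ S} |x_i|`, with values in `ℝ ∪ {∞}`. -/
noncomputable def objective {m n : ℕ} (g : (Fin m → ℝ) → EReal) (E : Matrix (Fin m) (Fin n) ℝ)
    (lam : ℝ) (S : Finset (Fin n)) (x : Fin n → ℝ) : EReal :=
  g (E.mulVec x) + ((lam * ∑ i ∈ S, |x i| : ℝ) : EReal)

/-- The points of `X` that agree with `a` in every coordinate other than `i`. -/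
def coordSlice {n : ℕ} (X : Set (Fin n → ℝ)) (i : Fin n) (a : Fin n → ℝ) : Set (Fin n → ℝ) :=
  {z | z ∈ X ∧ ∀ j, j ≠ i → z j = a j}

/-- `b` is a minimizer of `f` over the points of `X` that differ from `a` at most in
coordinate `i`. -/
def IsCoordArgmin {n : ℕ} (f : (Fin n → ℝ) → EReal) (X : Set (Fin n → ℝ)) (i : Fin n)
    (a b : Fin n → ℝ) : Prop :=
  b ∈ coordSlice X i a ∧ IsMinOn f (coordSlice X i a) b

/-- One full cycle: `b` is obtained from `a` by minimizing successively over the coordinates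
`1, …, n`, in this order; `y i` is the point reached after `i` coordinate minimizations. -/
def IsSweep {n : ℕ} (f : (Fin n → ℝ) → EReal) (X : Set (Fin n → ℝ)) (a b : Fin n → ℝ) : Prop :=
  ∃ y : Fin (n + 1) → (Fin n → ℝ), y 0 = a ∧ y (Fin.last n) = b ∧
    ∀ i : Fin n, IsCoordArgmin f X i (y i.castSucc) (y i.succ)

/-- `x` is a sequence of iterates of cyclic coordinatewise minimization of `f` over `X`, started
at `x₀`. -/
def IsCCMIterates {n : ℕ} (f : (Fin n → ℝ) → EReal) (X : Set (Fin n → ℝ)) (x₀ : Fin n → ℝ)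
    (x : ℕ → (Fin n → ℝ)) : Prop :=
  x 0 = x₀ ∧ ∀ r, IsSweep f X (x r) (x (r + 1))

/-! The method converges linearly even though `E` may have a kernel and the set of minimizers may be
unbounded. Fix a minimizer `z`, with `q_i = coordVariation g E lam S z i`. Since the penalty and the
constraints are separable, optimality of `z` yields `q_i ≥ 0` for each `i`, and the gap `f₁(x) -
f₁(z)` equals the Bregman distance of `g` from `Ez` to `Ex` plus `∑ q_i(x_i)` (`realObjective_sub`).
A bound on the gap thus confines `Ex`, though not `x`, to a Bregman sublevel set. Blow-up at the
boundary and positive definiteness make this set compact, so on it `g` is uniformly strongly convex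
with Lipschitz gradient.

Three estimates then hold for a sweep from `a` to `b`. Strong convexity along the nonzero columns
gives `‖b - a‖² ≤ M (f₁(a) - f₁(b))`. Coordinate optimality during the sweep gives, for suitable
optimal `u`, a gap at `b` of at most `B ‖b - a‖ ‖b - u‖` (`sweep_gap_le`). Finally, `u` can be
chosen with `‖b - u‖²` at most a multiple of the gap at `b`, by linear growth of each `q_i` and a
Hoffman bound (`exists_error_bound`). Together they make the gap after a sweep at most a multiple of
the decrease, so the gap shrinks by a fixed factor. The step lengths are then dominated by a
geometric series, and the iterates themselves converge. -/

section Calculus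

/-! ### Strong convexity and Bregman distances of C² functions -/

variable {V : Type*} [NormedAddCommGroup V] [NormedSpace ℝ V]

theorem differentiableAt_fderiv_of_contDiffOn_two {φ : V → ℝ} {C : Set V} (hC : IsOpen C)
    (hφ : ContDiffOn ℝ 2 φ C) {a : V} (ha : a ∈ C) : DifferentiableAt ℝ (fderiv ℝ φ) a :=
  ((hφ.fderiv_of_isOpen (m := 1) hC (by norm_num)).differentiableOn (by norm_num)).differentiableAt
    (hC.mem_nhds ha)

theorem differentiableAt_of_contDiffOn_two {φ : V → ℝ} {C : Set V} (hC : IsOpen C)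
    (hφ : ContDiffOn ℝ 2 φ C) {a : V} (ha : a ∈ C) : DifferentiableAt ℝ φ a :=
  (hφ.differentiableOn (by norm_num)).differentiableAt (hC.mem_nhds ha)

theorem continuousOn_fderiv_fderiv_of_contDiffOn_two {φ : V → ℝ} {C : Set V} (hC : IsOpen C)
    (hφ : ContDiffOn ℝ 2 φ C) : ContinuousOn (fderiv ℝ (fderiv ℝ φ)) C :=
  (hφ.fderiv_of_isOpen (m := 1) hC (by norm_num)).continuousOn_fderiv_of_isOpen hC (by norm_num)

/-- A `C²` function has a Lipschitz derivative on every compact convex subset of its domain. -/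
theorem exists_lipschitz_fderiv_of_isCompact {φ : V → ℝ} {C K : Set V} (hC : IsOpen C)
    (hφ : ContDiffOn ℝ 2 φ C) (hK : IsCompact K) (hKc : Convex ℝ K) (hKC : K ⊆ C) :
    ∃ L, 0 ≤ L ∧ ∀ a ∈ K, ∀ b ∈ K, ‖fderiv ℝ φ b - fderiv ℝ φ a‖ ≤ L * ‖b - a‖ := by
  have hcont : ContinuousOn (fun t => ‖fderiv ℝ (fderiv ℝ φ) t‖) K :=
    ContinuousOn.norm (E := V →L[ℝ] V →L[ℝ] ℝ)
      ((continuousOn_fderiv_fderiv_of_contDiffOn_two hC hφ).mono hKC)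
  obtain ⟨L, hL⟩ := (hK.image_of_continuousOn hcont).bddAbove
  rw [mem_upperBounds, Set.forall_mem_image] at hL
  refine ⟨max L 0, le_max_right _ _, fun a ha b hb => ?_⟩
  exact hKc.norm_image_sub_le_of_norm_hasFDerivWithin_le
    (fun x hx => (differentiableAt_fderiv_of_contDiffOn_two hC hφ
      (hKC hx)).hasFDerivAt.hasFDerivWithinAt)
    (fun x hx => (hL hx).trans (le_max_left _ _)) ha hb

/-- A quadratic form that is positive definite at every point of a compact set is so uniformly. -/
theorem exists_uniform_posDef_of_isCompact [FiniteDimensional ℝ V] {B : V → V →L[ℝ] V →L[ℝ] ℝ}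
    {K : Set V} (hK : IsCompact K) (hB : ContinuousOn B K)
    (hpos : ∀ t ∈ K, ∀ v, v ≠ 0 → 0 < B t v v) :
    ∃ c, 0 < c ∧ ∀ t ∈ K, ∀ v, c * ‖v‖ ^ 2 ≤ B t v v := by
  have hcpt : IsCompact (K ×ˢ Metric.sphere (0 : V) 1) := hK.prod (isCompact_sphere 0 1)
  have hcont : ContinuousOn (fun p : V × V => B p.1 p.2 p.2) (K ×ˢ Metric.sphere (0 : V) 1) := by
    have h1 : ContinuousOn (fun p : V × V => B p.1) (K ×ˢ Metric.sphere (0 : V) 1) :=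
      hB.comp continuousOn_fst fun p hp => hp.1
    exact (h1.clm_apply continuousOn_snd).clm_apply continuousOn_snd
  have key : ∃ c, 0 < c ∧ ∀ p ∈ K ×ˢ Metric.sphere (0 : V) 1, c ≤ B p.1 p.2 p.2 := by
    rcases (K ×ˢ Metric.sphere (0 : V) 1).eq_empty_or_nonempty with he | hne
    -- The product is empty when `K` is empty or `V` is trivial; any constant serves.
    · exact ⟨1, one_pos, by simp [he]⟩
    · obtain ⟨p, hp, hmin⟩ := hcpt.exists_isMinOn hne hcont
      refine ⟨_, hpos p.1 hp.1 p.2 ?_, fun q hq => hmin hq⟩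
      rintro h0
      have := hp.2
      simp [h0] at this
  obtain ⟨c, hc, h⟩ := key
  refine ⟨c, hc, fun t ht v => ?_⟩
  rcases eq_or_ne v 0 with rfl | hv
  · simp
  have hv' : ‖v‖ ≠ 0 := norm_ne_zero_iff.2 hv
  have h1 := h (t, ‖v‖⁻¹ • v) ⟨ht, by simp [norm_smul, hv']⟩
  have h2 : B t v v = ‖v‖ ^ 2 * B t (‖v‖⁻¹ • v) (‖v‖⁻¹ • v) := by
    simp only [map_smul, smul_apply, smul_eq_mul]
    field_simp
  rw [h2, mul_comm]
  exact mul_le_mul_of_nonneg_left h1 (by positivity)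

/-- A `C²` function with positive definite Hessian is strongly convex on every compact convex
subset of its domain. -/
theorem exists_strong_convexity_of_isCompact [FiniteDimensional ℝ V] {φ : V → ℝ} {C K : Set V}
    (hC : IsOpen C) (hφ : ContDiffOn ℝ 2 φ C)
    (hpos : ∀ t ∈ C, ∀ v, v ≠ 0 → 0 < fderiv ℝ (fderiv ℝ φ) t v v)
    (hK : IsCompact K) (hKc : Convex ℝ K) (hKC : K ⊆ C) :
    ∃ c, 0 < c ∧ ∀ a ∈ K, ∀ b ∈ K,
      φ a + fderiv ℝ φ a (b - a) + c * ‖b - a‖ ^ 2 ≤ φ b := by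
  obtain ⟨c, hc, h⟩ := exists_uniform_posDef_of_isCompact hK
    ((continuousOn_fderiv_fderiv_of_contDiffOn_two hC hφ).mono hKC)
    (fun t ht => hpos t (hKC ht))
  -- The Hessian bound `c` is integrated twice along the segment, in the form of two monotonicity
  -- statements; the second integration produces the factor `1/2`.
  refine ⟨c / 2, half_pos hc, fun a ha b hb => ?_⟩
  set v := b - a with hv
  have hmem : ∀ s ∈ Set.Icc (0 : ℝ) 1, a + s • v ∈ K := fun s hs => by
    have := hKc ha hb (sub_nonneg.2 hs.2) hs.1 (by ring)
    convert this using 1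
    simp only [hv]; module
  have hline : ∀ s : ℝ, HasDerivAt (fun s : ℝ => a + s • v) v s := fun s => by
    simpa using ((hasDerivAt_id s).smul_const v).const_add a
  have hd1 : ∀ s ∈ Set.Icc (0 : ℝ) 1,
      HasDerivAt (fun s : ℝ => φ (a + s • v)) (fderiv ℝ φ (a + s • v) v) s := fun s hs =>
    (differentiableAt_of_contDiffOn_two hC hφ
      (hKC (hmem s hs))).hasFDerivAt.comp_hasDerivAt s (hline s)
  have hd2 : ∀ s ∈ Set.Icc (0 : ℝ) 1, HasDerivAt (fun s : ℝ => fderiv ℝ φ (a + s • v) v)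
      (fderiv ℝ (fderiv ℝ φ) (a + s • v) v v) s := fun s hs => by
    have := (differentiableAt_fderiv_of_contDiffOn_two hC hφ
      (hKC (hmem s hs))).hasFDerivAt.comp_hasDerivAt s (hline s)
    simpa using this.clm_apply (hasDerivAt_const s v)
  have hmono1 : MonotoneOn (fun s : ℝ => fderiv ℝ φ (a + s • v) v - c * ‖v‖ ^ 2 * s)
      (Set.Icc 0 1) := by
    have hd : ∀ s ∈ Set.Icc (0 : ℝ) 1,
        HasDerivAt (fun s : ℝ => fderiv ℝ φ (a + s • v) v - c * ‖v‖ ^ 2 * s)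
        (fderiv ℝ (fderiv ℝ φ) (a + s • v) v v - c * ‖v‖ ^ 2) s := fun s hs => by
      have h3 := (hd2 s hs).sub ((hasDerivAt_id s).const_mul (c * ‖v‖ ^ 2))
      rw [mul_one] at h3
      exact h3
    refine monotoneOn_of_hasDerivWithinAt_nonneg (convex_Icc 0 1)
      (fun s hs => (hd s hs).continuousAt.continuousWithinAt)
      (fun s hs => (hd s (interior_subset hs)).hasDerivWithinAt)
      (fun s hs => sub_nonneg.2 (h _ (hmem s (interior_subset hs)) v))
  have hmono2 : MonotoneOn
      (fun s : ℝ => φ (a + s • v) - (fderiv ℝ φ a v * s + c / 2 * ‖v‖ ^ 2 * s ^ 2))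
      (Set.Icc 0 1) := by
    have hd : ∀ s ∈ Set.Icc (0 : ℝ) 1, HasDerivAt
        (fun s : ℝ => φ (a + s • v) - (fderiv ℝ φ a v * s + c / 2 * ‖v‖ ^ 2 * s ^ 2))
        (fderiv ℝ φ (a + s • v) v - (fderiv ℝ φ a v + c * ‖v‖ ^ 2 * s)) s := fun s hs => by
      have h3 := (hd1 s hs).sub (((hasDerivAt_id s).const_mul (fderiv ℝ φ a v)).add
        (((hasDerivAt_id s).pow 2).const_mul (c / 2 * ‖v‖ ^ 2)))
      have h4 : fderiv ℝ φ (a + s • v) v - (fderiv ℝ φ a v + c * ‖v‖ ^ 2 * s) =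
          fderiv ℝ φ (a + s • v) v - (fderiv ℝ φ a v * 1 +
            c / 2 * ‖v‖ ^ 2 * (((2 : ℕ) : ℝ) * id s ^ (2 - 1) * 1)) := by
        simp only [id, Nat.cast_ofNat]
        ring
      rw [h4]
      exact h3
    refine monotoneOn_of_hasDerivWithinAt_nonneg (convex_Icc 0 1)
      (fun s hs => (hd s hs).continuousAt.continuousWithinAt)
      (fun s hs => (hd s (interior_subset hs)).hasDerivWithinAt)
      (fun s hs => ?_)
    have hs' := interior_subset hs
    have := hmono1 (Set.left_mem_Icc.2 zero_le_one) hs' hs'.1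
    simp only [zero_smul, add_zero, mul_zero, sub_zero] at this
    linarith
  have := hmono2 (Set.left_mem_Icc.2 zero_le_one) (Set.right_mem_Icc.2 zero_le_one) zero_le_one
  simp only [zero_smul, add_zero, one_smul, hv, add_sub_cancel] at this
  rw [← hv] at this
  norm_num at this
  linarith

theorem tangent_le_of_posDef [FiniteDimensional ℝ V] {φ : V → ℝ} {C : Set V}
    (hC : IsOpen C) (hCc : Convex ℝ C) (hφ : ContDiffOn ℝ 2 φ C)
    (hpos : ∀ t ∈ C, ∀ v, v ≠ 0 → 0 < fderiv ℝ (fderiv ℝ φ) t v v) {a b : V}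
    (ha : a ∈ C) (hb : b ∈ C) : φ a + fderiv ℝ φ a (b - a) ≤ φ b := by
  have hK : IsCompact (segment ℝ a b) := by
    rw [segment_eq_image_lineMap]
    exact isCompact_Icc.image (by fun_prop)
  obtain ⟨c, hc, h⟩ := exists_strong_convexity_of_isCompact hC hφ hpos hK (convex_segment a b)
    (hCc.segment_subset ha hb)
  have := h a (left_mem_segment ℝ a b) b (right_mem_segment ℝ a b)
  nlinarith [sq_nonneg ‖b - a‖]

/-- The sublevel sets of the Bregman distance to a point are bounded. -/
theorem exists_bound_of_bregman_le [FiniteDimensional ℝ V] {φ : V → ℝ} {C : Set V}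
    (hC : IsOpen C) (hCc : ConvexOn ℝ C φ) (hφ : ContDiffOn ℝ 2 φ C)
    (hpos : ∀ t ∈ C, ∀ v, v ≠ 0 → 0 < fderiv ℝ (fderiv ℝ φ) t v v) {a : V} (ha : a ∈ C)
    (ρ : ℝ) : ∃ R, ∀ t ∈ C, φ t - φ a - fderiv ℝ φ a (t - a) ≤ ρ → ‖t - a‖ ≤ R := by
  obtain ⟨δ, hδ, hball⟩ := Metric.nhds_basis_closedBall.mem_iff.1 (hC.mem_nhds ha)
  obtain ⟨c, hc, h⟩ := exists_strong_convexity_of_isCompact hC hφ hpos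
    (isCompact_closedBall a δ) (convex_closedBall a δ) hball
  -- The Bregman distance is at least `c δ²` on the sphere of radius `δ`, and by convexity along
  -- rays at least `c δ N` at distance `N ≥ δ`.
  refine ⟨max δ (ρ / (c * δ)), fun t ht hle => ?_⟩
  by_contra! hlt
  obtain ⟨h1, h2⟩ := max_lt_iff.1 hlt
  set N := ‖t - a‖ with hN
  have hN0 : 0 < N := hδ.trans h1
  set u := δ / N with hu
  have hu0 : 0 < u := div_pos hδ hN0
  have hu1 : u ≤ 1 := (div_le_one hN0).2 h1.le
  have hmem : a + u • (t - a) ∈ Metric.closedBall a δ := by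
    rw [mem_closedBall_iff_norm, add_sub_cancel_left, norm_smul, Real.norm_of_nonneg hu0.le,
      ← hN, hu, div_mul_cancel₀ _ hN0.ne']
  have h3 := h a (Metric.mem_closedBall_self hδ.le) _ hmem
  have h4 := hCc.2 ha ht (sub_nonneg.2 hu1) hu0.le (by ring)
  have h5 : (1 - u) • a + u • t = a + u • (t - a) := by module
  rw [h5] at h4
  rw [add_sub_cancel_left, norm_smul, Real.norm_of_nonneg hu0.le, ← hN, map_smul] at h3
  simp only [smul_eq_mul] at h3 h4
  rw [div_lt_iff₀ (by positivity)] at h2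
  have h6 : u * N = δ := by rw [hu, div_mul_cancel₀ _ hN0.ne']
  rw [h6] at h3
  have h7 : c * δ ^ 2 ≤ u * ρ := by nlinarith
  have h8 : c * δ ^ 2 * N ≤ δ * ρ := by
    calc c * δ ^ 2 * N ≤ u * ρ * N := by gcongr
      _ = δ * ρ := by rw [← h6]; ring
  nlinarith

end Calculus

/-! ### A sign-conformal Hoffman bound -/

section Hoffman

variable {ι V : Type*} [Fintype ι] [NormedAddCommGroup V] [NormedSpace ℝ V]

/-- A vector that dominates no nonzero kernel vector in the sign-conformal order. -/
def ConformallyReduced (A : (ι → ℝ) →L[ℝ] V) (v : ι → ℝ) : Prop :=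
  ∀ k : ι → ℝ, A k = 0 → (∀ i, k i ≠ 0 → 0 < k i * v i) → k = 0

/-- Otherwise normalized counterexamples accumulate at a unit kernel vector `w`. Far along the
subsequence they have the signs of `w` wherever `w` is nonzero, so `w` itself contradicts their
being reduced. -/
theorem exists_norm_le_of_conformallyReduced (A : (ι → ℝ) →L[ℝ] V) :
    ∃ κ, 0 ≤ κ ∧ ∀ v, ConformallyReduced A v → ‖v‖ ≤ κ * ‖A v‖ := by
  by_contra! hcon
  choose v hv hlt using fun k : ℕ => hcon k k.cast_nonneg
  have hv0 : ∀ k, 0 < ‖v k‖ := fun k => lt_of_le_of_lt (by positivity) (hlt k)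
  obtain ⟨w, hw, θ, hθ, hlim⟩ := (isCompact_sphere (0 : ι → ℝ) 1).tendsto_subseq
    (x := fun k => ‖v k‖⁻¹ • v k) (fun k => by simp [norm_smul, (hv0 k).ne'])
  have hAw : A w = 0 := by
    have h1 : Tendsto (fun k => A (‖v (θ k)‖⁻¹ • v (θ k))) atTop (𝓝 (A w)) :=
      (A.continuous.tendsto w).comp hlim
    have h2 : Tendsto (fun k => A (‖v (θ k)‖⁻¹ • v (θ k))) atTop (𝓝 0) := by
      refine squeeze_zero_norm' ?_ (tendsto_inv_atTop_nhds_zero_nat (𝕜 := ℝ).comp hθ.tendsto_atTop)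
      filter_upwards [eventually_gt_atTop 0] with k hk
      have hk' : (0 : ℝ) < θ k := by
        exact_mod_cast lt_of_lt_of_le hk (hθ.id_le k)
      simp only [map_smul, norm_smul, norm_inv, norm_norm, Function.comp]
      rw [inv_mul_le_iff₀ (hv0 _), ← div_eq_mul_inv, le_div_iff₀ hk', mul_comm]
      exact (hlt (θ k)).le
    exact tendsto_nhds_unique h1 h2
  have hev : ∀ᶠ k in atTop, ∀ i, w i ≠ 0 → 0 < w i * v (θ k) i := by
    refine eventually_all.2 fun i => ?_
    by_cases hi : w i = 0
    · simp [hi]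
    have h1 : Tendsto (fun k => w i * (‖v (θ k)‖⁻¹ * v (θ k) i)) atTop (𝓝 (w i * w i)) := by
      have := (tendsto_pi_nhds.1 hlim i).const_mul (w i)
      simpa using this
    filter_upwards [h1.eventually (lt_mem_nhds (mul_self_pos.2 hi))] with k hk _
    rw [mul_left_comm] at hk
    exact (pos_iff_pos_of_mul_pos hk).1 (inv_pos.2 (hv0 _))
  obtain ⟨k, hk⟩ := hev.exists
  have := hv (θ k) w hAw hk
  rw [this] at hw
  simp at hw

/-- An `ℓ¹`-minimal solution in the box spanned by `0` and `w` is reduced: subtracting a small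
multiple of a conformal kernel vector would stay in the box and lower the `ℓ¹` norm. -/
theorem exists_conformallyReduced (A : (ι → ℝ) →L[ℝ] V) (w : ι → ℝ) :
    ∃ w', A w' = A w ∧ (∀ i, w' i ∈ Set.uIcc 0 (w i)) ∧ ConformallyReduced A w' := by
  classical
  set P : Set (ι → ℝ) := Set.univ.pi (fun i => Set.uIcc 0 (w i)) ∩ {u | A u = A w} with hP
  have hPc : IsCompact P := (isCompact_univ_pi fun i => isCompact_uIcc).inter_right
    (isClosed_eq A.continuous continuous_const)
  have hne : P.Nonempty := ⟨w, fun i _ => Set.right_mem_uIcc, rfl⟩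
  obtain ⟨u, hu, hmin⟩ := hPc.exists_isMinOn hne
    (f := fun u : ι → ℝ => ∑ i, |u i|) (by fun_prop)
  refine ⟨u, hu.2, fun i => hu.1 i (Set.mem_univ i), fun k hk hsign => ?_⟩
  by_contra hk0
  obtain ⟨i₀, hi₀⟩ := Function.ne_iff.1 hk0
  simp only [Pi.zero_apply] at hi₀
  have hev : ∀ᶠ ε : ℝ in 𝓝[>] 0, ∀ i, k i ≠ 0 → ε * |k i| ≤ |u i| := by
    refine eventually_all.2 fun i => ?_
    by_cases hi : k i = 0
    · simp [hi]
    have hui : 0 < |u i| := abs_pos.2 fun h => by simpa [h] using hsign i hi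
    have h1 : Tendsto (fun ε : ℝ => ε * |k i|) (𝓝[>] 0) (𝓝 (0 * |k i|)) :=
      (tendsto_id.mul_const _).mono_left nhdsWithin_le_nhds
    rw [zero_mul] at h1
    filter_upwards [h1.eventually (gt_mem_nhds hui)] with ε hε _ using hε.le
  obtain ⟨ε, hε, hε0⟩ := (hev.and self_mem_nhdsWithin).exists
  have hε0 : 0 < ε := hε0
  have hcoord : ∀ i, |u i - ε * k i| = |u i| - ε * |k i| ∧ u i - ε * k i ∈ Set.uIcc 0 (u i) := by
    intro i
    by_cases hi : k i = 0
    · simp [hi]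
    have h1 := hε i hi
    have h2 := hsign i hi
    rcases lt_or_gt_of_ne hi with hneg | hpos
    · have hui : u i < 0 := (neg_iff_neg_of_mul_pos h2).1 hneg
      rw [abs_of_neg hui, abs_of_neg hneg] at h1 ⊢
      have h3 : ε * k i < 0 := mul_neg_of_pos_of_neg hε0 hneg
      rw [abs_of_nonpos (by linarith), Set.uIcc_of_ge hui.le]
      exact ⟨by ring, by constructor <;> linarith⟩
    · have hui : 0 < u i := (pos_iff_pos_of_mul_pos h2).1 hpos
      rw [abs_of_pos hui, abs_of_pos hpos] at h1 ⊢
      have h3 : 0 < ε * k i := mul_pos hε0 hpos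
      rw [abs_of_nonneg (by linarith), Set.uIcc_of_le hui.le]
      exact ⟨rfl, by constructor <;> linarith⟩
  have hmem : u - ε • k ∈ P := by
    refine ⟨fun i _ => ?_, ?_⟩
    · exact Set.uIcc_subset_uIcc Set.left_mem_uIcc (hu.1 i (Set.mem_univ i)) (by
        simpa using (hcoord i).2)
    · have : A u = A w := hu.2
      simp [hk, this]
  have h1 : ∑ i, |u i| ≤ ∑ i, |(u - ε • k) i| := hmin hmem
  have h2 : ∑ i, |(u - ε • k) i| < ∑ i, |u i| := by
    refine Finset.sum_lt_sum (fun i _ => ?_) ⟨i₀, Finset.mem_univ _, ?_⟩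
    · simp only [Pi.sub_apply, Pi.smul_apply, smul_eq_mul, (hcoord i).1]
      have : 0 ≤ ε * |k i| := by positivity
      linarith
    · simp only [Pi.sub_apply, Pi.smul_apply, smul_eq_mul, (hcoord i₀).1]
      have : 0 < ε * |k i₀| := mul_pos hε0 (abs_pos.2 hi₀)
      linarith
  linarith

/-- Hoffman's error bound for linear equations over a box, in sign-conformal form. -/
theorem exists_hoffman_const (A : (ι → ℝ) →L[ℝ] V) :
    ∃ κ, 0 ≤ κ ∧ ∀ w : ι → ℝ, ∃ w', A w' = A w ∧ (∀ i, w' i ∈ Set.uIcc 0 (w i)) ∧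
      ‖w'‖ ≤ κ * ‖A w‖ := by
  obtain ⟨κ, hκ, h⟩ := exists_norm_le_of_conformallyReduced A
  refine ⟨κ, hκ, fun w => ?_⟩
  obtain ⟨w', h1, h2, h3⟩ := exists_conformallyReduced A w
  exact ⟨w', h1, h2, h1 ▸ h w' h3⟩

end Hoffman

/-! ### Boundary blow-up and compact Bregman sublevel sets -/

section Barrier

variable {m n : ℕ}

/-- A smooth convex function with positive definite Hessian and open effective domain that is
continuous as a function with values in `EReal`, so that it blows up at the boundary. -/
structure IsSmoothConvexBarrier (g : (Fin m → ℝ) → EReal) : Prop where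
  ne_bot : ∀ t, g t ≠ ⊥
  isOpen : IsOpen (effDom g)
  convexOn : ConvexOn ℝ (effDom g) (finitePart g)
  contDiffOn : ContDiffOn ℝ 2 (finitePart g) (effDom g)
  hessian_pos : ∀ t ∈ effDom g, ∀ v, v ≠ 0 → 0 < fderiv ℝ (fderiv ℝ (finitePart g)) t v v
  continuous : Continuous g

theorem coe_finitePart {g : (Fin m → ℝ) → EReal} (hbot : ∀ t, g t ≠ ⊥) {t : Fin m → ℝ}
    (ht : t ∈ effDom g) : ((finitePart g t : ℝ) : EReal) = g t :=
  EReal.coe_toReal (ne_of_lt ht) (hbot t)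

theorem effDom_eq_domInterior {g : (Fin m → ℝ) → EReal} (hbot : ∀ t, g t ≠ ⊥)
    (hconv : ConvexOn ℝ (effDom g) (finitePart g)) (hne : (domInterior g).Nonempty)
    (hblow : ∀ b ∈ frontier (domInterior g), Tendsto g (𝓝[domInterior g] b) (𝓝 ⊤)) :
    effDom g = domInterior g := by
  refine Set.Subset.antisymm (fun b hb => ?_) interior_subset
  by_contra hbC
  obtain ⟨c, hc⟩ := hne
  have hcl : b ∈ closure (domInterior g) := by
    rw [domInterior, hconv.1.closure_interior_eq_closure_of_nonempty_interior ⟨c, hc⟩]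
    exact subset_closure hb
  have hfr : b ∈ frontier (domInterior g) := by
    rw [(show IsOpen (domInterior g) from isOpen_interior).frontier_eq]
    exact ⟨hcl, hbC⟩
  have hpath : ∀ᶠ s : ℝ in 𝓝[>] 0, s • c + (1 - s) • b ∈ domInterior g ∧
      g (s • c + (1 - s) • b) ≤ ((max (finitePart g c) (finitePart g b) : ℝ) : EReal) := by
    filter_upwards [Ioo_mem_nhdsGT (zero_lt_one (α := ℝ))] with s hs
    have h1 : s • c + (1 - s) • b ∈ domInterior g :=
      hconv.1.combo_interior_self_mem_interior hc hb hs.1 (by linarith [hs.2]) (by ring)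
    refine ⟨h1, ?_⟩
    rw [← coe_finitePart hbot (interior_subset h1), EReal.coe_le_coe_iff]
    exact hconv.le_on_segment (interior_subset hc) hb
      ⟨s, 1 - s, hs.1.le, by linarith [hs.2], by ring, rfl⟩
  have hlim : Tendsto (fun s : ℝ => s • c + (1 - s) • b) (𝓝[>] 0) (𝓝[domInterior g] b) := by
    refine tendsto_nhdsWithin_iff.2 ⟨?_, hpath.mono fun s hs => hs.1⟩
    have : Tendsto (fun s : ℝ => s • c + (1 - s) • b) (𝓝 0) (𝓝 ((0 : ℝ) • c + (1 - 0 : ℝ) • b)) :=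
      Continuous.tendsto (by fun_prop) 0
    simp only [zero_smul, sub_zero, one_smul, zero_add] at this
    exact this.mono_left nhdsWithin_le_nhds
  have := le_of_tendsto ((hblow b hfr).comp hlim) (hpath.mono fun s hs => hs.2)
  simp at this

theorem continuous_of_tendsto_top {g : (Fin m → ℝ) → EReal} (hbot : ∀ t, g t ≠ ⊥)
    (heq : effDom g = domInterior g) (hcont : ContinuousOn (finitePart g) (domInterior g))
    (hblow : ∀ b ∈ frontier (domInterior g), Tendsto g (𝓝[domInterior g] b) (𝓝 ⊤)) :
    Continuous g := by
  have hopen : IsOpen (domInterior g) := isOpen_interior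
  have htop : ∀ t, t ∉ domInterior g → g t = ⊤ := fun t ht => by
    rw [← heq] at ht
    exact not_lt_top_iff.1 ht
  refine continuous_iff_continuousAt.2 fun t => ?_
  by_cases ht : t ∈ domInterior g
  · have h1 : ContinuousAt (fun u => ((finitePart g u : ℝ) : EReal)) t :=
      continuous_coe_real_ereal.continuousAt.comp (hcont.continuousAt (hopen.mem_nhds ht))
    refine h1.congr ?_
    filter_upwards [hopen.mem_nhds ht] with u hu
    exact coe_finitePart hbot (heq ▸ hu)
  · have h1 : Tendsto g (𝓝[(domInterior g)ᶜ] t) (𝓝 ⊤) := by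
      refine tendsto_const_nhds.congr' ?_
      filter_upwards [self_mem_nhdsWithin] with u hu using (htop u hu).symm
    have h2 : Tendsto g (𝓝[domInterior g] t) (𝓝 ⊤) := by
      by_cases hcl : t ∈ closure (domInterior g)
      · refine hblow t ?_
        rw [frontier, hopen.interior_eq]
        exact ⟨hcl, ht⟩
      · rw [notMem_closure_iff_nhdsWithin_eq_bot.1 hcl]
        exact tendsto_bot
    rw [ContinuousAt, htop t ht, ← nhdsWithin_univ, ← Set.union_compl_self (domInterior g),
      nhdsWithin_union]
    exact h2.sup h1

theorem isSmoothConvexBarrier {g : (Fin m → ℝ) → EReal} (hbot : ∀ t, g t ≠ ⊥)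
    (hconv : ConvexOn ℝ (effDom g) (finitePart g)) (hne : (domInterior g).Nonempty)
    (hsmooth : ContDiffOn ℝ 2 (finitePart g) (domInterior g))
    (hpos : ∀ t ∈ domInterior g, ∀ v, v ≠ 0 → 0 < hessianForm g t v)
    (hblow : ∀ b ∈ frontier (domInterior g), Tendsto g (𝓝[domInterior g] b) (𝓝 ⊤)) :
    IsSmoothConvexBarrier g := by
  have heq := effDom_eq_domInterior hbot hconv hne hblow
  refine ⟨hbot, ?_, hconv, ?_, ?_, continuous_of_tendsto_top hbot heq hsmooth.continuousOn hblow⟩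
  · rw [heq]; exact isOpen_interior
  · rwa [heq]
  · rw [heq]; exact hpos

namespace IsSmoothConvexBarrier

variable {g : (Fin m → ℝ) → EReal}

theorem differentiableAt (hg : IsSmoothConvexBarrier g) {t : Fin m → ℝ} (ht : t ∈ effDom g) :
    DifferentiableAt ℝ (finitePart g) t :=
  differentiableAt_of_contDiffOn_two hg.isOpen hg.contDiffOn ht

theorem tangent_le (hg : IsSmoothConvexBarrier g) {a b : Fin m → ℝ} (ha : a ∈ effDom g)
    (hb : b ∈ effDom g) :
    finitePart g a + fderiv ℝ (finitePart g) a (b - a) ≤ finitePart g b :=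
  tangent_le_of_posDef hg.isOpen hg.convexOn.1 hg.contDiffOn hg.hessian_pos ha hb

end IsSmoothConvexBarrier

/-- The sublevel set at height `ρ` of the Bregman distance of `g` to `a`. -/
def bregmanSublevel (g : (Fin m → ℝ) → EReal) (a : Fin m → ℝ) (ρ : ℝ) : Set (Fin m → ℝ) :=
  {t | t ∈ effDom g ∧ finitePart g t - finitePart g a - fderiv ℝ (finitePart g) a (t - a) ≤ ρ}

theorem bregmanSublevel_subset (g : (Fin m → ℝ) → EReal) (a : Fin m → ℝ) (ρ : ℝ) :
    bregmanSublevel g a ρ ⊆ effDom g := fun _ h => h.1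

theorem mem_bregmanSublevel_self {g : (Fin m → ℝ) → EReal} {a : Fin m → ℝ} (ha : a ∈ effDom g)
    {ρ : ℝ} (hρ : 0 ≤ ρ) : a ∈ bregmanSublevel g a ρ := ⟨ha, by simpa using hρ⟩

/-- Continuity of `g` into `EReal` makes the set closed in the whole space and not only in the
effective domain; growth of the Bregman distance makes it bounded. -/
theorem isCompact_bregmanSublevel {g : (Fin m → ℝ) → EReal} (hg : IsSmoothConvexBarrier g)
    {a : Fin m → ℝ} (ha : a ∈ effDom g) (ρ : ℝ) : IsCompact (bregmanSublevel g a ρ) := by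
  refine Metric.isCompact_of_isClosed_isBounded ?_ ?_
  · have : bregmanSublevel g a ρ =
        {t | g t ≤ ((ρ + finitePart g a + fderiv ℝ (finitePart g) a (t - a) : ℝ) : EReal)} := by
      ext t
      constructor
      · rintro ⟨h1, h2⟩
        simp only [Set.mem_ofPred_eq]
        rw [← coe_finitePart hg.ne_bot h1, EReal.coe_le_coe_iff]
        linarith
      · intro h
        simp only [Set.mem_ofPred_eq] at h
        have h1 : t ∈ effDom g := lt_of_le_of_lt h (EReal.coe_lt_top _)
        rw [← coe_finitePart hg.ne_bot h1, EReal.coe_le_coe_iff] at h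
        exact ⟨h1, by linarith⟩
    rw [this]
    exact isClosed_le hg.continuous (continuous_coe_real_ereal.comp (by fun_prop))
  · obtain ⟨R, hR⟩ := exists_bound_of_bregman_le hg.isOpen hg.convexOn hg.contDiffOn
      hg.hessian_pos ha ρ
    refine (Metric.isBounded_closedBall (x := a) (r := R)).subset fun t ht => ?_
    rw [mem_closedBall_iff_norm]
    exact hR t ht.1 ht.2

theorem convex_bregmanSublevel {g : (Fin m → ℝ) → EReal} (hg : IsSmoothConvexBarrier g)
    (a : Fin m → ℝ) (ρ : ℝ) : Convex ℝ (bregmanSublevel g a ρ) := by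
  intro s hs t ht p q hp hq hpq
  refine ⟨hg.convexOn.1 hs.1 ht.1 hp hq hpq, ?_⟩
  have h1 := hg.convexOn.2 hs.1 ht.1 hp hq hpq
  have h2 : p • s + q • t - a = p • (s - a) + q • (t - a) := by
    have : a = (p + q) • a := by rw [hpq, one_smul]
    nth_rewrite 1 [this]
    module
  rw [h2, map_add, map_smul, map_smul]
  simp only [smul_eq_mul] at h1 ⊢
  have h3 := mul_le_mul_of_nonneg_left hs.2 hp
  have h4 := mul_le_mul_of_nonneg_left ht.2 hq
  have h5 : finitePart g a = p * finitePart g a + q * finitePart g a := by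
    rw [← add_mul, hpq, one_mul]
  have h6 : ρ = p * ρ + q * ρ := by rw [← add_mul, hpq, one_mul]
  linarith

end Barrier

/-! ### First-order conditions and sufficient decrease in one coordinate -/

section CoordinateStep

variable {m n : ℕ}

/-- The weights of the `ℓ¹` penalty: `lam` on `S`, zero elsewhere. -/
def l1Weight {n : ℕ} (lam : ℝ) (S : Finset (Fin n)) (i : Fin n) : ℝ := if i ∈ S then lam else 0

theorem l1Weight_nonneg {lam : ℝ} (hlam : 0 ≤ lam) (S : Finset (Fin n)) (i : Fin n) :
    0 ≤ l1Weight lam S i := by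
  unfold l1Weight; split_ifs <;> simp [hlam]

theorem sum_l1Weight_mul (lam : ℝ) (S : Finset (Fin n)) (x : Fin n → ℝ) :
    lam * ∑ i ∈ S, |x i| = ∑ i, l1Weight lam S i * |x i| := by
  simp [l1Weight, Finset.mul_sum, ite_mul, Finset.sum_ite_mem]

/-- The real value of the objective on its effective domain. -/
noncomputable def realObjective (g : (Fin m → ℝ) → EReal) (E : Matrix (Fin m) (Fin n) ℝ)
    (lam : ℝ) (S : Finset (Fin n)) (x : Fin n → ℝ) : ℝ :=
  finitePart g (E.mulVec x) + ∑ i, l1Weight lam S i * |x i|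

theorem objective_eq_coe {g : (Fin m → ℝ) → EReal} (hbot : ∀ t, g t ≠ ⊥)
    (E : Matrix (Fin m) (Fin n) ℝ) (lam : ℝ) (S : Finset (Fin n)) {x : Fin n → ℝ}
    (hx : E.mulVec x ∈ effDom g) :
    objective g E lam S x = (realObjective g E lam S x : ℝ) := by
  rw [objective, realObjective, sum_l1Weight_mul, EReal.coe_add, coe_finitePart hbot hx]

theorem mulVec_mem_effDom {g : (Fin m → ℝ) → EReal} {E : Matrix (Fin m) (Fin n) ℝ} {lam : ℝ}
    {S : Finset (Fin n)} {x : Fin n → ℝ} (hx : objective g E lam S x < ⊤) :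
    E.mulVec x ∈ effDom g := by
  refine lt_top_iff_ne_top.2 (fun h => ?_ : g (E.mulVec x) ≠ ⊤)
  rw [objective, h, EReal.top_add_coe] at hx
  exact lt_irrefl _ hx

theorem objective_lt_top {g : (Fin m → ℝ) → EReal} (hbot : ∀ t, g t ≠ ⊥)
    {E : Matrix (Fin m) (Fin n) ℝ} (lam : ℝ) (S : Finset (Fin n)) {x : Fin n → ℝ}
    (hx : E.mulVec x ∈ effDom g) : objective g E lam S x < ⊤ := by
  rw [objective_eq_coe hbot E lam S hx]
  exact EReal.coe_lt_top _

theorem continuous_objective {g : (Fin m → ℝ) → EReal} (hg : Continuous g)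
    (E : Matrix (Fin m) (Fin n) ℝ) (lam : ℝ) (S : Finset (Fin n)) :
    Continuous (objective g E lam S) := by
  refine continuous_iff_continuousAt.2 fun x => ?_
  have h1 : ContinuousAt (fun x : Fin n → ℝ => g (E.mulVec x)) x :=
    (hg.comp (continuous_const.matrix_mulVec continuous_id)).continuousAt
  have h2 : ContinuousAt (fun x : Fin n → ℝ => ((lam * ∑ i ∈ S, |x i| : ℝ) : EReal)) x :=
    (continuous_coe_real_ereal.comp (by fun_prop)).continuousAt
  exact (EReal.continuousAt_add (Or.inr (EReal.coe_ne_bot _)) (Or.inr (EReal.coe_ne_top _))).comp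
    (f := fun x : Fin n → ℝ => (g (E.mulVec x), ((lam * ∑ i ∈ S, |x i| : ℝ) : EReal)))
    (h1.prodMk h2)

theorem isClosed_feasibleSet (S : Finset (Fin n)) : IsClosed (feasibleSet S) := by
  simp only [feasibleSet, Set.ofPred_forall]
  exact isClosed_iInter fun i => isClosed_iInter fun _ =>
    isClosed_le continuous_const (continuous_apply i)

theorem coordSlice_eq_of_mem {X : Set (Fin n → ℝ)} {i : Fin n} {a b : Fin n → ℝ}
    (hb : b ∈ coordSlice X i a) : coordSlice X i b = coordSlice X i a := by
  ext x
  exact and_congr_right fun _ => forall_congr' fun j => imp_congr_right fun hj => by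
    rw [hb.2 j hj]

theorem eq_update_of_forall_ne {i : Fin n} {a b : Fin n → ℝ} (h : ∀ j, j ≠ i → b j = a j) :
    b = Function.update a i (b i) := by
  ext j
  by_cases hj : j = i
  · subst hj; simp
  · simp [hj, h j hj]

theorem update_mem_coordSlice {S : Finset (Fin n)} {i : Fin n} {a : Fin n → ℝ}
    (ha : a ∈ feasibleSet S) {s : ℝ} (hs : i ∉ S → 0 ≤ s) :
    Function.update a i s ∈ coordSlice (feasibleSet S) i a := by
  refine ⟨fun j hj => ?_, fun j hj => by simp [hj]⟩
  by_cases hji : j = i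
  · subst hji; simpa using hs hj
  · simpa [hji] using ha j hj

theorem mulVec_update (E : Matrix (Fin m) (Fin n) ℝ) (a : Fin n → ℝ) (i : Fin n) (s : ℝ) :
    E.mulVec (Function.update a i s) = E.mulVec a + (s - a i) • E.col i := by
  have : Function.update a i s = a + (s - a i) • Pi.single i 1 := by
    ext j
    by_cases hj : j = i
    · subst hj; simp
    · simp [hj]
  rw [this, Matrix.mulVec_add, Matrix.mulVec_smul, Matrix.mulVec_single_one]

theorem sum_weight_update_sub (μ a : Fin n → ℝ) (i : Fin n) (s : ℝ) :
    ∑ j, μ j * |Function.update a i s j| - ∑ j, μ j * |a j| = μ i * (|s| - |a i|) := by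
  rw [← Finset.sum_sub_distrib, Finset.sum_eq_single i]
  · simp; ring
  · intro j _ hj; simp [hj]
  · simp

theorem norm_col_pos {E : Matrix (Fin m) (Fin n) ℝ} {i : Fin n} (hE : ∃ k, E k i ≠ 0) :
    0 < ‖E.col i‖ := by
  obtain ⟨k, hk⟩ := hE
  exact norm_pos_iff.2 fun h => hk (congrFun h k)

/-- The directional derivative of the objective in coordinate `i` at `b`, towards the value `s`. -/
noncomputable def coordVariation (g : (Fin m → ℝ) → EReal) (E : Matrix (Fin m) (Fin n) ℝ)
    (lam : ℝ) (S : Finset (Fin n)) (b : Fin n → ℝ) (i : Fin n) (s : ℝ) : ℝ :=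
  (s - b i) * fderiv ℝ (finitePart g) (E.mulVec b) (E.col i) + l1Weight lam S i * (|s| - |b i|)

/-- Moving a fraction `τ` of the way to `s` changes the penalty by at most `τ` times its full
change, by convexity. Dividing by `τ` and letting `τ → 0+` linearizes `g` only, while the penalty
enters through its full difference. -/
theorem coordVariation_nonneg {g : (Fin m → ℝ) → EReal} (hg : IsSmoothConvexBarrier g)
    {E : Matrix (Fin m) (Fin n) ℝ} {lam : ℝ} (hlam : 0 ≤ lam) {S : Finset (Fin n)}
    {b : Fin n → ℝ} {i : Fin n} (hbX : b ∈ feasibleSet S) (hb : E.mulVec b ∈ effDom g)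
    (hmin : IsMinOn (objective g E lam S) (coordSlice (feasibleSet S) i b) b)
    {s : ℝ} (hs : i ∉ S → 0 ≤ s) : 0 ≤ coordVariation g E lam S b i s := by
  set v := (s - b i) • E.col i with hv
  set μ := l1Weight lam S i with hμ
  have hμ0 : 0 ≤ μ := l1Weight_nonneg hlam S i
  have hd : HasDerivAt (fun τ : ℝ => finitePart g (E.mulVec b + τ • v))
      (fderiv ℝ (finitePart g) (E.mulVec b) v) 0 := by
    have h1 : HasDerivAt (fun τ : ℝ => E.mulVec b + τ • v) v 0 := by
      simpa using ((hasDerivAt_id (0 : ℝ)).smul_const v).const_add (E.mulVec b)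
    have h2 : HasFDerivAt (finitePart g) (fderiv ℝ (finitePart g) (E.mulVec b))
        (E.mulVec b + (0 : ℝ) • v) := by
      simpa using (hg.differentiableAt hb).hasFDerivAt
    exact h2.comp_hasDerivAt 0 h1
  have hlim : Tendsto (fun τ : ℝ => τ⁻¹ * (finitePart g (E.mulVec b + τ • v) -
      finitePart g (E.mulVec b))) (𝓝[>] 0) (𝓝 (fderiv ℝ (finitePart g) (E.mulVec b) v)) := by
    simpa using hd.tendsto_slope_zero_right
  have hdom : ∀ᶠ τ : ℝ in 𝓝[>] 0, E.mulVec b + τ • v ∈ effDom g := by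
    have h1 : Tendsto (fun τ : ℝ => E.mulVec b + τ • v) (𝓝 0) (𝓝 (E.mulVec b + (0 : ℝ) • v)) :=
      Continuous.tendsto (by fun_prop) 0
    simp only [zero_smul, add_zero] at h1
    exact (h1.mono_left nhdsWithin_le_nhds) (hg.isOpen.mem_nhds hb)
  have hge : ∀ᶠ τ : ℝ in 𝓝[>] 0, -(μ * (|s| - |b i|)) ≤
      τ⁻¹ * (finitePart g (E.mulVec b + τ • v) - finitePart g (E.mulVec b)) := by
    filter_upwards [hdom, Ioo_mem_nhdsGT (zero_lt_one (α := ℝ))] with τ hτ hτ01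
    set p := b i + τ * (s - b i) with hp
    have hp' : p = (1 - τ) * b i + τ * s := by rw [hp]; ring
    have hpS : i ∉ S → 0 ≤ p := fun hi => by
      rw [hp']
      exact add_nonneg (mul_nonneg (by linarith [hτ01.2]) (hbX i hi))
        (mul_nonneg hτ01.1.le (hs hi))
    have hmem := update_mem_coordSlice hbX hpS
    have hEx : E.mulVec (Function.update b i p) = E.mulVec b + τ • v := by
      rw [mulVec_update, hp, hv, smul_smul]; ring_nf
    have h1 : objective g E lam S b ≤ objective g E lam S (Function.update b i p) := hmin hmem
    rw [objective_eq_coe hg.ne_bot E lam S hb,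
      objective_eq_coe hg.ne_bot E lam S (hEx ▸ hτ), EReal.coe_le_coe_iff, realObjective,
      realObjective, hEx] at h1
    have h2 := sum_weight_update_sub (l1Weight lam S) b i p
    rw [← hμ] at h2
    have h3 : |p| ≤ (1 - τ) * |b i| + τ * |s| := by
      rw [hp']
      refine (abs_add_le _ _).trans ?_
      rw [abs_mul, abs_mul, abs_of_pos hτ01.1, abs_of_pos (sub_pos.2 hτ01.2)]
    have h4 : μ * (|p| - |b i|) ≤ τ * (μ * (|s| - |b i|)) := by
      calc μ * (|p| - |b i|) ≤ μ * (τ * (|s| - |b i|)) :=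
            mul_le_mul_of_nonneg_left (by linarith) hμ0
        _ = _ := by ring
    rw [le_inv_mul_iff₀ hτ01.1]
    linarith
  have := ge_of_tendsto hlim hge
  rw [hv, map_smul, smul_eq_mul] at this
  rw [coordVariation, ← hμ]
  linarith

/-- Sufficient decrease: `a` is the point before a coordinate step and `b` the point after it. The
quadratic gain is that of `g` along the column. -/
theorem realObjective_add_le_of_coordVariation_nonneg {g : (Fin m → ℝ) → EReal}
    {E : Matrix (Fin m) (Fin n) ℝ} {lam : ℝ} {S : Finset (Fin n)} {K : Set (Fin m → ℝ)} {c : ℝ}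
    (hc : ∀ s ∈ K, ∀ t ∈ K, finitePart g s + fderiv ℝ (finitePart g) s (t - s) +
      c * ‖t - s‖ ^ 2 ≤ finitePart g t) {a b : Fin n → ℝ} {i : Fin n}
    (ha : E.mulVec a ∈ K) (hb : E.mulVec b ∈ K) (hab : ∀ j, j ≠ i → a j = b j)
    (hvar : 0 ≤ coordVariation g E lam S b i (a i)) :
    realObjective g E lam S b + c * ‖E.col i‖ ^ 2 * (a i - b i) ^ 2 ≤
      realObjective g E lam S a := by
  have h1 := eq_update_of_forall_ne hab
  have h2 := sum_weight_update_sub (l1Weight lam S) b i (a i)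
  rw [← h1] at h2
  have h3 : E.mulVec a - E.mulVec b = (a i - b i) • E.col i := by
    conv_lhs => rw [h1, mulVec_update]
    simp
  have h4 := hc _ hb _ ha
  rw [h3, map_smul, norm_smul, mul_pow, Real.norm_eq_abs, sq_abs, smul_eq_mul] at h4
  rw [coordVariation] at hvar
  rw [realObjective, realObjective]
  linarith

end CoordinateStep

/-! ### One-dimensional piecewise linear growth -/

section OneDimensional

/-- A nonnegative function `s ↦ (s - ζ) d + μ (|s| - |ζ|)` on a line or a half-line grows linearly
away from its zero set. -/
theorem exists_linear_growth {d μ ζ : ℝ} {N : Prop} (hζ : N → 0 ≤ ζ)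
    (hq : ∀ s, (N → 0 ≤ s) → 0 ≤ (s - ζ) * d + μ * (|s| - |ζ|)) :
    ∃ C, 0 ≤ C ∧ ∀ s, (N → 0 ≤ s) → ∃ s', (N → 0 ≤ s') ∧
      (s' - ζ) * d + μ * (|s'| - |ζ|) = 0 ∧ |s - s'| ≤ C * ((s - ζ) * d + μ * (|s| - |ζ|)) := by
  -- The values at `0` and `2ζ`, both allowed, are opposite numbers, so nonnegativity forces them to
  -- vanish. The function then equals `s d + μ |s|`, linear on each half-line.
  have hz : ζ * d + μ * |ζ| = 0 := by
    have h1 := hq 0 fun _ => le_rfl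
    have h2 := hq (2 * ζ) fun h => by linarith [hζ h]
    rw [abs_mul, abs_two] at h2
    rw [abs_zero] at h1
    linarith
  have hform : ∀ s, (s - ζ) * d + μ * (|s| - |ζ|) = s * d + μ * |s| := fun s => by linarith
  simp only [hform] at hq ⊢
  -- `μ + d` and `μ - d` are the growth rates in `|s|` on the two half-lines. A zero rate
  -- contributes `0⁻¹ = 0`, harmlessly, since the function vanishes on that side.
  refine ⟨|μ + d|⁻¹ + |μ - d|⁻¹, by positivity, fun s hs => ?_⟩
  have hqs := hq s hs
  by_cases h0 : s * d + μ * |s| = 0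
  · exact ⟨s, hs, h0, by simp [h0]⟩
  refine ⟨0, fun _ => le_rfl, by simp, ?_⟩
  rw [sub_zero, add_mul]
  have h3 : 0 ≤ |μ + d|⁻¹ * (s * d + μ * |s|) := by positivity
  have h4 : 0 ≤ |μ - d|⁻¹ * (s * d + μ * |s|) := by positivity
  rcases le_total 0 s with hs0 | hs0
  · rw [abs_of_nonneg hs0] at *
    have h5 : s * d + μ * s = (μ + d) * s := by ring
    have h6 : μ + d ≠ 0 := fun h => h0 (by rw [h5, h, zero_mul])
    have h7 : |μ + d|⁻¹ * (s * d + μ * s) = s := by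
      rw [← abs_of_nonneg hqs, h5, abs_mul, abs_of_nonneg hs0, inv_mul_cancel_left₀]
      exact abs_ne_zero.2 h6
    linarith
  · rw [abs_of_nonpos hs0] at *
    have h5 : s * d + μ * -s = (μ - d) * -s := by ring
    have h6 : μ - d ≠ 0 := fun h => h0 (by rw [h5, h, zero_mul])
    have h7 : |μ - d|⁻¹ * (s * d + μ * -s) = -s := by
      rw [← abs_of_nonneg hqs, h5, abs_mul, abs_of_nonneg (neg_nonneg.2 hs0),
        inv_mul_cancel_left₀]
      exact abs_ne_zero.2 h6
    linarith

/-- The zero set of a nonnegative convex function is convex. -/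
theorem zero_of_mem_uIcc_of_zero {d μ ζ : ℝ} {N : Prop} (hμ : 0 ≤ μ)
    (hq : ∀ s, (N → 0 ≤ s) → 0 ≤ (s - ζ) * d + μ * (|s| - |ζ|)) {u v w : ℝ}
    (hu : N → 0 ≤ u) (hv : N → 0 ≤ v) (hu0 : (u - ζ) * d + μ * (|u| - |ζ|) = 0)
    (hv0 : (v - ζ) * d + μ * (|v| - |ζ|) = 0) (hw : w ∈ Set.uIcc u v) :
    (N → 0 ≤ w) ∧ (w - ζ) * d + μ * (|w| - |ζ|) = 0 := by
  rw [← segment_eq_uIcc] at hw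
  obtain ⟨p, q, hp, hq', hpq, rfl⟩ := hw
  simp only [smul_eq_mul]
  have hN : N → 0 ≤ p * u + q * v := fun h =>
    add_nonneg (mul_nonneg hp (hu h)) (mul_nonneg hq' (hv h))
  refine ⟨hN, le_antisymm ?_ (hq _ hN)⟩
  have h1 : |p * u + q * v| ≤ p * |u| + q * |v| := by
    refine (abs_add_le _ _).trans ?_
    rw [abs_mul, abs_mul, abs_of_nonneg hp, abs_of_nonneg hq']
  have h2 := mul_le_mul_of_nonneg_left h1 hμ
  have hp' : p = 1 - q := by linarith
  subst hp'
  have h3 : (1 - q) * ((u - ζ) * d + μ * (|u| - |ζ|)) = 0 := by rw [hu0, mul_zero]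
  have h4 : q * ((v - ζ) * d + μ * (|v| - |ζ|)) = 0 := by rw [hv0, mul_zero]
  linarith

end OneDimensional

/-! ### Distance to the optimal set -/

section ErrorBound

variable {m n : ℕ}

theorem exists_mulVec_norm_le (E : Matrix (Fin m) (Fin n) ℝ) :
    ∃ A, 0 ≤ A ∧ ∀ x, ‖E.mulVec x‖ ≤ A * ‖x‖ :=
  ⟨_, norm_nonneg _, (LinearMap.toContinuousLinearMap (Matrix.mulVecLin E)).le_opNorm⟩

theorem coordVariation_self (g : (Fin m → ℝ) → EReal) (E : Matrix (Fin m) (Fin n) ℝ) (lam : ℝ)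
    (S : Finset (Fin n)) (z : Fin n → ℝ) (i : Fin n) :
    coordVariation g E lam S z i (z i) = 0 := by simp [coordVariation]

/-- The distance of a feasible point to the set of optimal points is bounded by the residuals of
the optimality conditions. -/
theorem exists_error_bound {g : (Fin m → ℝ) → EReal} {E : Matrix (Fin m) (Fin n) ℝ} {lam : ℝ}
    (hlam : 0 ≤ lam) {S : Finset (Fin n)} {z : Fin n → ℝ} (hz : z ∈ feasibleSet S)
    (hq : ∀ i s, (i ∉ S → 0 ≤ s) → 0 ≤ coordVariation g E lam S z i s) :
    ∃ C₁ C₂, 0 ≤ C₁ ∧ 0 ≤ C₂ ∧ ∀ x ∈ feasibleSet S, ∃ u ∈ feasibleSet S,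
      E.mulVec u = E.mulVec z ∧ (∀ i, coordVariation g E lam S z i (u i) = 0) ∧
      ‖x - u‖ ≤ C₁ * ∑ i, coordVariation g E lam S z i (x i) +
        C₂ * ‖E.mulVec x - E.mulVec z‖ := by
  obtain ⟨A, hA0, hA⟩ := exists_mulVec_norm_le E
  obtain ⟨κ, hκ0, hκ⟩ := exists_hoffman_const (LinearMap.toContinuousLinearMap E.mulVecLin)
  simp only [LinearMap.coe_toContinuousLinearMap', Matrix.mulVecLin_apply] at hκ
  choose C hC0 hC using fun i => exists_linear_growth (hz i) (hq i)
  have hsumC : 0 ≤ ∑ i, C i := Finset.sum_nonneg fun i _ => hC0 i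
  refine ⟨(∑ i, C i) * (1 + κ * A), κ, by positivity, hκ0, fun x hx => ?_⟩
  choose x' hx'S hx'0 hx' using fun i => hC i (x i) (hx i)
  -- `x'` has zero variations but possibly the wrong image under `E`. The conformal correction `w`
  -- repairs the image while keeping each `x' i + w i` between `x' i` and `z i`, both zeros, so the
  -- variations stay zero.
  obtain ⟨w, hw, hwI, hwn⟩ := hκ (z - x')
  have hu : ∀ i, (i ∉ S → 0 ≤ (x' + w) i) ∧ coordVariation g E lam S z i ((x' + w) i) = 0 := by
    intro i
    refine zero_of_mem_uIcc_of_zero (l1Weight_nonneg hlam S i) (hq i) (hx'S i) (hz i) (hx'0 i)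
      (coordVariation_self g E lam S z i) ?_
    have h1 : x' i + w i ∈ Set.image (fun s => x' i + s) (Set.uIcc 0 ((z - x') i)) :=
      Set.mem_image_of_mem _ (hwI i)
    rw [Set.image_const_add_uIcc] at h1
    simpa using h1
  refine ⟨x' + w, fun i hi => (hu i).1 hi, ?_, fun i => (hu i).2, ?_⟩
  · rw [Matrix.mulVec_add, hw, Matrix.mulVec_sub, add_sub_cancel]
  set Q := ∑ i, coordVariation g E lam S z i (x i) with hQ
  have hqx : ∀ i, 0 ≤ coordVariation g E lam S z i (x i) := fun i => hq i _ (hx i)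
  have hQ0 : 0 ≤ Q := Finset.sum_nonneg fun i _ => hqx i
  have hxx' : ‖x - x'‖ ≤ (∑ i, C i) * Q := by
    refine (pi_norm_le_iff_of_nonneg (by positivity)).2 fun i => ?_
    refine (hx' i).trans (mul_le_mul ?_ ?_ (hqx i) hsumC)
    · exact Finset.single_le_sum (fun j _ => hC0 j) (Finset.mem_univ i)
    · exact Finset.single_le_sum (fun j _ => hqx j) (Finset.mem_univ i)
  have h1 : ‖E.mulVec (z - x')‖ ≤ ‖E.mulVec x - E.mulVec z‖ + A * ‖x - x'‖ := by
    have : E.mulVec (z - x') = -(E.mulVec x - E.mulVec z) + E.mulVec (x - x') := by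
      simp only [Matrix.mulVec_sub]; abel
    rw [this]
    exact (norm_add_le _ _).trans (by rw [norm_neg]; gcongr; exact hA _)
  calc ‖x - (x' + w)‖ = ‖(x - x') - w‖ := by rw [sub_add_eq_sub_sub]
    _ ≤ ‖x - x'‖ + ‖w‖ := norm_sub_le _ _
    _ ≤ ‖x - x'‖ + κ * (‖E.mulVec x - E.mulVec z‖ + A * ‖x - x'‖) := by
        gcongr; exact hwn.trans (by gcongr)
    _ = (1 + κ * A) * ‖x - x'‖ + κ * ‖E.mulVec x - E.mulVec z‖ := by ring
    _ ≤ (1 + κ * A) * ((∑ i, C i) * Q) + κ * ‖E.mulVec x - E.mulVec z‖ := by gcongr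
    _ = _ := by ring

theorem apply_mulVec_eq_sum (D : (Fin m → ℝ) →L[ℝ] ℝ) (E : Matrix (Fin m) (Fin n) ℝ)
    (x : Fin n → ℝ) : D (E.mulVec x) = ∑ i, x i * D (E.col i) := by
  have : E.mulVec x = ∑ i, x i • E.col i := by
    ext k
    simp [Matrix.mulVec, dotProduct, mul_comm]
  rw [this, map_sum]
  simp

/-- At a `z` satisfying the coordinate conditions, the Bregman term and every variation of a
feasible point are nonnegative, so each is bounded by the gap. -/
theorem realObjective_sub (g : (Fin m → ℝ) → EReal) (E : Matrix (Fin m) (Fin n) ℝ) (lam : ℝ)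
    (S : Finset (Fin n)) (x z : Fin n → ℝ) :
    realObjective g E lam S x - realObjective g E lam S z =
      (finitePart g (E.mulVec x) - finitePart g (E.mulVec z) -
        fderiv ℝ (finitePart g) (E.mulVec z) (E.mulVec x - E.mulVec z)) +
      ∑ i, coordVariation g E lam S z i (x i) := by
  simp only [realObjective, coordVariation, ← Matrix.mulVec_sub, apply_mulVec_eq_sum,
    Finset.sum_add_distrib, mul_sub, Finset.sum_sub_distrib, Pi.sub_apply]
  ring

theorem mulVec_mem_bregmanSublevel {g : (Fin m → ℝ) → EReal} {E : Matrix (Fin m) (Fin n) ℝ}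
    {lam : ℝ} {S : Finset (Fin n)} {z : Fin n → ℝ}
    (hq : ∀ i s, (i ∉ S → 0 ≤ s) → 0 ≤ coordVariation g E lam S z i s) {x : Fin n → ℝ}
    (hx : x ∈ feasibleSet S) (hxE : E.mulVec x ∈ effDom g) {ρ : ℝ}
    (hρ : realObjective g E lam S x - realObjective g E lam S z ≤ ρ) :
    E.mulVec x ∈ bregmanSublevel g (E.mulVec z) ρ := by
  refine ⟨hxE, ?_⟩
  rw [realObjective_sub] at hρ
  have : 0 ≤ ∑ i, coordVariation g E lam S z i (x i) :=
    Finset.sum_nonneg fun i _ => hq i _ (hx i)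
  linarith

end ErrorBound

/-! ### Unique sequences under an invariant -/

section Iteration

theorem existsUnique_seq {α : Type*} {P : α → Prop} {R : α → α → Prop}
    (hex : ∀ a, P a → ∃ b, R a b) (hP : ∀ a b, P a → R a b → P b)
    (huniq : ∀ a b b', P a → R a b → R a b' → b = b') {a : α} (ha : P a) :
    ∃! x : ℕ → α, x 0 = a ∧ ∀ r, R (x r) (x (r + 1)) := by
  classical
  have hmem : ∀ x : ℕ → α, x 0 = a → (∀ r, R (x r) (x (r + 1))) → ∀ r, P (x r) := by
    intro x h0 h r
    induction r with
    | zero => exact h0 ▸ ha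
    | succ r ih => exact hP _ _ ih (h r)
  choose! f hf using hex
  have hP' : ∀ r : ℕ, P (f^[r] a) := fun r => by
    induction r with
    | zero => exact ha
    | succ r ih => rw [Function.iterate_succ_apply']; exact hP _ _ ih (hf _ ih)
  refine ⟨fun r => f^[r] a, ⟨rfl, fun r => ?_⟩, ?_⟩
  · simp only [Function.iterate_succ_apply']
    exact hf _ (hP' r)
  · rintro x ⟨h0, h⟩
    funext r
    induction r with
    | zero => exact h0
    | succ r ih =>
      have h1 : R (f^[r] a) (x (r + 1)) := by simpa only [ih] using h r
      rw [Function.iterate_succ_apply']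
      exact huniq _ _ _ (hP' r) h1 (hf _ (hP' r))

theorem existsUnique_finSeq {α : Type*} {n : ℕ} {P : α → Prop} {R : Fin n → α → α → Prop}
    (hex : ∀ i a, P a → ∃ b, R i a b) (hP : ∀ i a b, P a → R i a b → P b)
    (huniq : ∀ i a b b', P a → R i a b → R i a b' → b = b') {a : α} (ha : P a) :
    ∃! y : Fin (n + 1) → α, y 0 = a ∧ ∀ i, R i (y i.castSucc) (y i.succ) := by
  classical
  choose! f hf using hex
  let y : Fin (n + 1) → α := fun k => Fin.induction (motive := fun _ => α) a (fun i => f i) k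
  have hy : ∀ i : Fin n, y i.succ = f i (y i.castSucc) := fun i => Fin.induction_succ _ _ _
  have hyP : ∀ k, P (y k) := fun k => by
    induction k using Fin.induction with
    | zero => exact ha
    | succ i ih => rw [hy]; exact hP i _ _ ih (hf i _ ih)
  refine ⟨y, ⟨rfl, fun i => ?_⟩, ?_⟩
  · rw [hy]
    exact hf i _ (hyP _)
  · rintro x ⟨h0, h⟩
    funext k
    induction k using Fin.induction with
    | zero => exact h0
    | succ i ih =>
      have h1 := h i
      rw [ih] at h1
      rw [hy]
      exact huniq i _ _ _ (hyP _) h1 (hf i _ (hyP _))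

end Iteration

/-! ### Existence and uniqueness of coordinate minimizers -/

section Descent

variable {m n : ℕ} {g : (Fin m → ℝ) → EReal} {E : Matrix (Fin m) (Fin n) ℝ} {lam : ℝ}
  {S : Finset (Fin n)}

/-- A feasible point at which the objective is finite. -/
def IsAdmissible (g : (Fin m → ℝ) → EReal) (E : Matrix (Fin m) (Fin n) ℝ) (S : Finset (Fin n))
    (x : Fin n → ℝ) : Prop :=
  x ∈ feasibleSet S ∧ E.mulVec x ∈ effDom g

theorem IsCoordArgmin.objective_le {a b : Fin n → ℝ} {i : Fin n} {f : (Fin n → ℝ) → EReal}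
    {X : Set (Fin n → ℝ)} (h : IsCoordArgmin f X i a b) (ha : a ∈ X) : f b ≤ f a :=
  h.2 ⟨ha, fun _ _ => rfl⟩

theorem IsCoordArgmin.isAdmissible (hbot : ∀ t, g t ≠ ⊥) {a b : Fin n → ℝ} {i : Fin n}
    (h : IsCoordArgmin (objective g E lam S) (feasibleSet S) i a b) (ha : IsAdmissible g E S a) :
    IsAdmissible g E S b :=
  ⟨h.1.1, mulVec_mem_effDom ((h.objective_le ha.1).trans_lt (objective_lt_top hbot lam S ha.2))⟩

theorem IsCoordArgmin.realObjective_le (hbot : ∀ t, g t ≠ ⊥) {a b : Fin n → ℝ} {i : Fin n}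
    (h : IsCoordArgmin (objective g E lam S) (feasibleSet S) i a b) (ha : IsAdmissible g E S a) :
    realObjective g E lam S b ≤ realObjective g E lam S a := by
  have h1 := h.objective_le ha.1
  rwa [objective_eq_coe hbot E lam S ha.2,
    objective_eq_coe hbot E lam S (h.isAdmissible hbot ha).2, EReal.coe_le_coe_iff] at h1

theorem IsCoordArgmin.coordVariation_nonneg (hg : IsSmoothConvexBarrier g) (hlam : 0 ≤ lam)
    {a b : Fin n → ℝ} {i : Fin n}
    (h : IsCoordArgmin (objective g E lam S) (feasibleSet S) i a b) (ha : IsAdmissible g E S a)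
    {s : ℝ} (hs : i ∉ S → 0 ≤ s) : 0 ≤ coordVariation g E lam S b i s := by
  have hb := h.isAdmissible hg.ne_bot ha
  refine _root_.coordVariation_nonneg hg hlam hb.1 hb.2 ?_ hs
  rw [coordSlice_eq_of_mem h.1]
  exact h.2

/-- Strong convexity on the segment between the two images bounds the squared difference by a
nonpositive number; the nonzero column makes the coefficient positive. -/
theorem IsCoordArgmin.unique (hg : IsSmoothConvexBarrier g) (hlam : 0 ≤ lam)
    (hE : ∀ j, ∃ i, E i j ≠ 0) {a b b' : Fin n → ℝ} {i : Fin n} (ha : IsAdmissible g E S a)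
    (h : IsCoordArgmin (objective g E lam S) (feasibleSet S) i a b)
    (h' : IsCoordArgmin (objective g E lam S) (feasibleSet S) i a b') : b = b' := by
  have hb := h.isAdmissible hg.ne_bot ha
  have hb' := h'.isAdmissible hg.ne_bot ha
  have hslice : ∀ j, j ≠ i → b' j = b j := fun j hj => (h'.1.2 j hj).trans (h.1.2 j hj).symm
  have hle : realObjective g E lam S b' ≤ realObjective g E lam S b := by
    have h1 : objective g E lam S b' ≤ objective g E lam S b := h'.2 h.1
    rwa [objective_eq_coe hg.ne_bot E lam S hb.2, objective_eq_coe hg.ne_bot E lam S hb'.2,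
      EReal.coe_le_coe_iff] at h1
  have hcpt : IsCompact (segment ℝ (E.mulVec b) (E.mulVec b')) := by
    rw [segment_eq_image_lineMap]
    exact isCompact_Icc.image (by fun_prop)
  obtain ⟨c, hc, hstrong⟩ := exists_strong_convexity_of_isCompact hg.isOpen hg.contDiffOn
    hg.hessian_pos hcpt (convex_segment _ _) (hg.convexOn.1.segment_subset hb.2 hb'.2)
  have h1 := realObjective_add_le_of_coordVariation_nonneg (lam := lam) (S := S) hstrong
    (right_mem_segment ℝ _ _) (left_mem_segment ℝ _ _) hslice
    (h.coordVariation_nonneg hg hlam ha (hb'.1 i))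
  have h2 : c * ‖E.col i‖ ^ 2 * (b' i - b i) ^ 2 ≤ 0 := by linarith
  have h3 : 0 < c * ‖E.col i‖ ^ 2 := mul_pos hc (pow_pos (norm_col_pos (hE i)) 2)
  have h4 : b' i - b i = 0 := by
    have := nonpos_of_mul_nonpos_right h2 h3
    exact pow_eq_zero_iff two_ne_zero |>.1 (le_antisymm this (sq_nonneg _))
  funext j
  by_cases hj : j = i
  · subst hj; linarith
  · exact (hslice j hj).symm

/-- The minimum is attained because the sublevel part of the slice is compact: its image lies in a
compact Bregman sublevel set, and along the slice the image moves with speed `‖E.col i‖ > 0`. -/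
theorem exists_isCoordArgmin (hg : IsSmoothConvexBarrier g) (hE : ∀ j, ∃ i, E i j ≠ 0)
    {z : Fin n → ℝ} (hzE : E.mulVec z ∈ effDom g)
    (hq : ∀ i s, (i ∉ S → 0 ≤ s) → 0 ≤ coordVariation g E lam S z i s) (i : Fin n)
    {a : Fin n → ℝ} (ha : IsAdmissible g E S a) :
    ∃ b, IsCoordArgmin (objective g E lam S) (feasibleSet S) i a b := by
  set f := objective g E lam S with hf
  have hfc : Continuous f := continuous_objective hg.continuous E lam S
  set T := coordSlice (feasibleSet S) i a ∩ {b | f b ≤ f a} with hT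
  have haT : a ∈ T := ⟨⟨ha.1, fun _ _ => rfl⟩, le_refl (f a)⟩
  have hclosed : IsClosed T := by
    refine IsClosed.inter ?_ (isClosed_le hfc continuous_const)
    have h1 : IsClosed {b : Fin n → ℝ | ∀ j, j ≠ i → b j = a j} := by
      simp only [Set.ofPred_forall]
      exact isClosed_iInter fun j => isClosed_iInter fun _ =>
        isClosed_eq (continuous_apply j) continuous_const
    exact (isClosed_feasibleSet S).inter h1
  set K := bregmanSublevel g (E.mulVec z)
    (realObjective g E lam S a - realObjective g E lam S z) with hK
  have hKcpt : IsCompact K := isCompact_bregmanSublevel hg hzE _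
  have hTK : ∀ b ∈ T, E.mulVec b ∈ K := fun b hb => by
    have hbE : E.mulVec b ∈ effDom g :=
      mulVec_mem_effDom (lt_of_le_of_lt hb.2 (objective_lt_top hg.ne_bot lam S ha.2))
    have h1 : f b ≤ f a := hb.2
    rw [hf, objective_eq_coe hg.ne_bot E lam S ha.2, objective_eq_coe hg.ne_bot E lam S hbE,
      EReal.coe_le_coe_iff] at h1
    exact mulVec_mem_bregmanSublevel hq hb.1.1 hbE (by linarith)
  have hbdd : Bornology.IsBounded T := by
    refine (Metric.isBounded_closedBall (x := a) (r := Metric.diam K / ‖E.col i‖)).subset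
      fun b hb => ?_
    have hpos := norm_col_pos (hE i)
    rw [mem_closedBall_iff_norm]
    refine (pi_norm_le_iff_of_nonneg (div_nonneg Metric.diam_nonneg hpos.le)).2 fun j => ?_
    by_cases hj : j = i
    · subst hj
      have h1 := Metric.dist_le_diam_of_mem hKcpt.isBounded (hTK b hb) (hTK a haT)
      rw [dist_eq_norm, eq_update_of_forall_ne hb.1.2, mulVec_update, add_sub_cancel_left,
        norm_smul] at h1
      rwa [le_div_iff₀ hpos]
    · simpa [hb.1.2 j hj] using div_nonneg Metric.diam_nonneg hpos.le
  obtain ⟨b, hb, hmin⟩ := (Metric.isCompact_of_isClosed_isBounded hclosed hbdd).exists_isMinOn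
    ⟨a, haT⟩ hfc.continuousOn
  refine ⟨b, hb.1, fun c hc => ?_⟩
  by_cases hca : f c ≤ f a
  · exact hmin ⟨hc, hca⟩
  · exact (show f b ≤ f a from hb.2).trans (not_le.1 hca).le

end Descent

/-! ### Contraction of the gap in one sweep -/

section Sweep

variable {m n : ℕ} {g : (Fin m → ℝ) → EReal} {E : Matrix (Fin m) (Fin n) ℝ} {lam : ℝ}
  {S : Finset (Fin n)}

theorem IsSweep.isAdmissible (hbot : ∀ t, g t ≠ ⊥) {a b : Fin n → ℝ}
    (h : IsSweep (objective g E lam S) (feasibleSet S) a b) (ha : IsAdmissible g E S a) :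
    IsAdmissible g E S b := by
  obtain ⟨y, rfl, rfl, hstep⟩ := h
  suffices ∀ k, IsAdmissible g E S (y k) from this _
  intro k
  induction k using Fin.induction with
  | zero => exact ha
  | succ i ih => exact (hstep i).isAdmissible hbot ih

theorem existsUnique_isCCMIterates (hg : IsSmoothConvexBarrier g) (hlam : 0 ≤ lam)
    (hE : ∀ j, ∃ i, E i j ≠ 0) {z : Fin n → ℝ} (hzE : E.mulVec z ∈ effDom g)
    (hq : ∀ i s, (i ∉ S → 0 ≤ s) → 0 ≤ coordVariation g E lam S z i s) {x₀ : Fin n → ℝ}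
    (hx₀ : IsAdmissible g E S x₀) :
    ∃! x, IsCCMIterates (objective g E lam S) (feasibleSet S) x₀ x := by
  have key : ∀ a, IsAdmissible g E S a → ∃! y : Fin (n + 1) → (Fin n → ℝ), y 0 = a ∧
      ∀ i : Fin n, IsCoordArgmin (objective g E lam S) (feasibleSet S) i
        (y i.castSucc) (y i.succ) := fun a ha =>
    existsUnique_finSeq (P := IsAdmissible g E S)
      (fun i a ha => exists_isCoordArgmin hg hE hzE hq i ha)
      (fun i a b ha h => h.isAdmissible hg.ne_bot ha)
      (fun i a b b' ha h h' => h.unique hg hlam hE ha h') ha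
  refine existsUnique_seq (P := IsAdmissible g E S) (fun a ha => ?_)
    (fun a b ha h => h.isAdmissible hg.ne_bot ha) (fun a b b' ha h h' => ?_) hx₀
  · obtain ⟨y, ⟨h0, hy⟩, -⟩ := key a ha
    exact ⟨_, y, h0, rfl, hy⟩
  · obtain ⟨y, h0, hl, hy⟩ := h
    obtain ⟨y', h0', hl', hy'⟩ := h'
    rw [← hl, ← hl', (key a ha).unique ⟨h0, hy⟩ ⟨h0', hy'⟩]

/-- Along a sweep every coordinate is changed exactly once. -/
theorem sweep_coord {y : Fin (n + 1) → (Fin n → ℝ)}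
    (h : ∀ i : Fin n, ∀ j, j ≠ i → y i.succ j = y i.castSucc j) (j : Fin n) (k : Fin (n + 1)) :
    (k.val ≤ j.val → y k j = y 0 j) ∧ (j.val < k.val → y k j = y j.succ j) := by
  induction k using Fin.induction with
  | zero => simp
  | succ i ih =>
    by_cases hj : j = i
    · subst hj; simp
    · have hj' : j.val ≠ i.val := fun h => hj (Fin.ext h)
      rw [h i j hj]
      simp only [Fin.val_castSucc, Fin.val_succ] at ih ⊢
      exact ⟨fun h => ih.1 (by omega), fun h => ih.2 (by omega)⟩

/-- With indices from `0`, `y k` carries the new values in coordinates below `k` and the old ones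
from `k` on. -/
theorem sweep_coord_eq {y : Fin (n + 1) → (Fin n → ℝ)}
    (h : ∀ i : Fin n, ∀ j, j ≠ i → y i.succ j = y i.castSucc j) (j : Fin n) (k : Fin (n + 1)) :
    (k.val ≤ j.val → y k j = y 0 j) ∧ (j.val < k.val → y k j = y (Fin.last n) j) := by
  refine ⟨(sweep_coord h j k).1, fun hk => ?_⟩
  rw [(sweep_coord h j k).2 hk, (sweep_coord h j (Fin.last n)).2 (by simp)]

theorem sum_sub_succ_castSucc (F : Fin (n + 1) → ℝ) :
    ∑ i : Fin n, (F i.castSucc - F i.succ) = F 0 - F (Fin.last n) := by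
  have h1 := Fin.sum_univ_castSucc F
  have h2 := Fin.sum_univ_succ F
  rw [Finset.sum_sub_distrib]
  linarith

/-- Here `d` stands for the step length, `e` for the distance to an optimal point, `r` for `‖Eb -
Ez‖` and `Q` for the sum of variations. With `F = fb - fz`, the bounds give `e² ≤ D F`, then `F² ≤ W
(fa - fb) F`, and hence `F ≤ W ((fa - fz) - F)`. -/
theorem contraction_of_bounds {c C₁ C₂ M B ρ d e r Q fa fb fz : ℝ} (hc : 0 < c) (hM : 0 ≤ M)
    (hB : 0 ≤ B) (hd : 0 ≤ d) (he : 0 ≤ e) (hQ : 0 ≤ Q)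
    (hab : 0 ≤ fa - fb) (hρ : fa - fz ≤ ρ) (hgap : fb - fz ≤ B * d * e)
    (herr : e ≤ C₁ * Q + C₂ * r) (hBreg : c * r ^ 2 ≤ fb - fz - Q)
    (hmove : d ^ 2 ≤ M * (fa - fb)) :
    fb - fz ≤ B ^ 2 * (2 * (C₁ ^ 2 * ρ + C₂ ^ 2 / c)) * M /
      (1 + B ^ 2 * (2 * (C₁ ^ 2 * ρ + C₂ ^ 2 / c)) * M) * (fa - fz) := by
  set D := 2 * (C₁ ^ 2 * ρ + C₂ ^ 2 / c) with hD
  set W := B ^ 2 * D * M with hW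
  obtain ⟨F, hF⟩ : ∃ F, F = fb - fz := ⟨_, rfl⟩
  rw [← hF] at hgap hBreg ⊢
  have hQF : Q ≤ F := by
    have : 0 ≤ c * r ^ 2 := by positivity
    linarith
  have hF0 : 0 ≤ F := hQ.trans hQF
  have hFρ : F ≤ ρ := by linarith
  have hρ0 : 0 ≤ ρ := hF0.trans hFρ
  have hD0 : 0 ≤ D := by positivity
  have hW0 : 0 ≤ W := by positivity
  have hdist : e ^ 2 ≤ D * F := by
    have h1 : r ^ 2 ≤ F / c := by
      rw [le_div_iff₀ hc]; linarith
    -- The a priori bound `ρ` on the gap turns the term linear in `Q` into one of order `√F`.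
    have h2 : Q ^ 2 ≤ ρ * F := by
      rw [sq]; exact mul_le_mul (hQF.trans hFρ) hQF hQ hρ0
    calc e ^ 2 ≤ (C₁ * Q + C₂ * r) ^ 2 := by gcongr
      _ ≤ 2 * (C₁ ^ 2 * Q ^ 2 + C₂ ^ 2 * r ^ 2) := by
          nlinarith [sq_nonneg (C₁ * Q - C₂ * r)]
      _ ≤ 2 * (C₁ ^ 2 * (ρ * F) + C₂ ^ 2 * (F / c)) := by gcongr
      _ = D * F := by rw [hD]; ring
  have hFW : F ≤ W * (fa - fb) := by
    rcases hF0.eq_or_lt with h0 | hpos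
    · rw [← h0]; positivity
    have h1 : F * F ≤ W * (fa - fb) * F := by
      calc F * F ≤ (B * d * e) * (B * d * e) := mul_le_mul hgap hgap hF0 (by positivity)
        _ = B ^ 2 * d ^ 2 * e ^ 2 := by ring
        _ ≤ B ^ 2 * (M * (fa - fb)) * (D * F) := by gcongr
        _ = _ := by rw [hW]; ring
    exact le_of_mul_le_mul_right h1 hpos
  rw [div_mul_eq_mul_div, le_div_iff₀ (by positivity)]
  have : fa - fb = (fa - fz) - F := by rw [hF]; ring
  rw [this] at hFW
  linarith

/-- The optimality gap after a sweep is controlled by the length of the step and the distance to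
any optimal point `u`. -/
theorem sweep_gap_le {K : Set (Fin m → ℝ)} {L A : ℝ} (hL0 : 0 ≤ L)
    (hL : ∀ s ∈ K, ∀ t ∈ K,
      ‖fderiv ℝ (finitePart g) t - fderiv ℝ (finitePart g) s‖ ≤ L * ‖t - s‖)
    (hA0 : 0 ≤ A) (hA : ∀ x, ‖E.mulVec x‖ ≤ A * ‖x‖)
    (htan : ∀ s ∈ K, ∀ t ∈ K,
      finitePart g s + fderiv ℝ (finitePart g) s (t - s) ≤ finitePart g t)
    {z : Fin n → ℝ} (hzK : E.mulVec z ∈ K) {y : Fin (n + 1) → (Fin n → ℝ)}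
    (hyK : ∀ k, E.mulVec (y k) ∈ K)
    (hy : ∀ i : Fin n, ∀ j, j ≠ i → y i.succ j = y i.castSucc j)
    (hvar : ∀ (i : Fin n) (s : ℝ), (i ∉ S → 0 ≤ s) →
      0 ≤ coordVariation g E lam S (y i.succ) i s)
    {u : Fin n → ℝ} (huX : u ∈ feasibleSet S) (huE : E.mulVec u = E.mulVec z)
    (hu0 : ∀ i, coordVariation g E lam S z i (u i) = 0) :
    realObjective g E lam S (y (Fin.last n)) - realObjective g E lam S z ≤
      (∑ i : Fin n, L * A * ‖E.col i‖) * ‖y (Fin.last n) - y 0‖ * ‖y (Fin.last n) - u‖ := by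
  have hcoord := sweep_coord_eq hy
  set b := y (Fin.last n) with hb
  set a := y 0 with ha
  have hbK : E.mulVec b ∈ K := hyK _
  have hbi : ∀ i : Fin n, y i.succ i = b i := fun i => (hcoord i i.succ).2 (by simp)
  have hEbu : E.mulVec b - E.mulVec z = E.mulVec (b - u) := by rw [Matrix.mulVec_sub, huE]
  have h2 : finitePart g (E.mulVec b) - finitePart g (E.mulVec z) ≤
      fderiv ℝ (finitePart g) (E.mulVec b) (E.mulVec (b - u)) := by
    have h1 := htan _ hbK _ hzK
    rw [← neg_sub (E.mulVec b), hEbu, map_neg] at h1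
    linarith
  -- Since the variation vanishes at `u i`, its base point can be moved from `z` to `u`.
  have h5 : ∀ i, coordVariation g E lam S z i (b i) =
      (b i - u i) * fderiv ℝ (finitePart g) (E.mulVec z) (E.col i) +
        l1Weight lam S i * (|b i| - |u i|) := fun i => by
    have := hu0 i
    rw [coordVariation] at this ⊢
    linarith
  have h6 : realObjective g E lam S b - realObjective g E lam S z ≤
      ∑ i, ((b i - u i) * fderiv ℝ (finitePart g) (E.mulVec b) (E.col i) +
        l1Weight lam S i * (|b i| - |u i|)) := by
    rw [realObjective_sub]
    simp only [h5, Finset.sum_add_distrib]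
    have h7 := apply_mulVec_eq_sum (fderiv ℝ (finitePart g) (E.mulVec z)) E (b - u)
    have h8 := apply_mulVec_eq_sum (fderiv ℝ (finitePart g) (E.mulVec b)) E (b - u)
    rw [hEbu]
    simp only [Pi.sub_apply] at h7 h8
    rw [← h7, ← h8]
    linarith
  refine h6.trans ?_
  rw [Finset.sum_mul, Finset.sum_mul]
  refine Finset.sum_le_sum fun i _ => ?_
  -- Coordinate `i` was optimal for the gradient at `y i.succ`, not at `b`. Testing that condition
  -- against `u i` leaves only the gradient discrepancy `Δ`, which the Lipschitz bound controls by
  -- the step length.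
  have h7 := hvar i (u i) (huX i)
  rw [coordVariation, hbi] at h7
  obtain ⟨Δ, hΔ⟩ : ∃ Δ, Δ = fderiv ℝ (finitePart g) (E.mulVec b) -
    fderiv ℝ (finitePart g) (E.mulVec (y i.succ)) := ⟨_, rfl⟩
  have h8 : ‖Δ‖ ≤ L * A * ‖b - a‖ := by
    have h9 : ‖b - y i.succ‖ ≤ ‖b - a‖ := by
      refine (pi_norm_le_iff_of_nonneg (norm_nonneg _)).2 fun j => ?_
      rcases le_or_gt (i.succ).val j.val with hj | hj
      · rw [Pi.sub_apply, (hcoord j _).1 hj]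
        exact norm_le_pi_norm (b - a) j
      · rw [Pi.sub_apply, (hcoord j _).2 hj]
        simp
    calc ‖Δ‖ ≤ L * ‖E.mulVec b - E.mulVec (y i.succ)‖ := hΔ ▸ hL _ (hyK _) _ hbK
      _ ≤ L * (A * ‖b - a‖) := by
          rw [← Matrix.mulVec_sub]
          exact mul_le_mul_of_nonneg_left
            ((hA _).trans (mul_le_mul_of_nonneg_left h9 hA0)) hL0
      _ = _ := by ring
  have h9 : (b i - u i) * Δ (E.col i) ≤ L * A * ‖E.col i‖ * ‖b - a‖ * ‖b - u‖ := by
    calc (b i - u i) * Δ (E.col i) ≤ |b i - u i| * |Δ (E.col i)| := by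
          rw [← abs_mul]; exact le_abs_self _
      _ ≤ ‖b - u‖ * ((L * A * ‖b - a‖) * ‖E.col i‖) := by
          refine mul_le_mul (norm_le_pi_norm (b - u) i) ?_ (abs_nonneg _) (norm_nonneg _)
          exact (Δ.le_opNorm _).trans (mul_le_mul_of_nonneg_right h8 (norm_nonneg _))
      _ = _ := by ring
  rw [hΔ, sub_apply] at h9
  linarith

/-- One sweep decreases the optimality gap by a fixed factor, and moves by at most a multiple of
the square root of the gap. -/
theorem exists_sweep_contraction (hg : IsSmoothConvexBarrier g) (hlam : 0 ≤ lam)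
    (hE : ∀ j, ∃ i, E i j ≠ 0) {z : Fin n → ℝ} (hz : IsAdmissible g E S z)
    (hq : ∀ i s, (i ∉ S → 0 ≤ s) → 0 ≤ coordVariation g E lam S z i s) {ρ : ℝ} (hρ : 0 ≤ ρ) :
    ∃ θ M, 0 ≤ θ ∧ θ < 1 ∧ 0 ≤ M ∧ ∀ a b, IsAdmissible g E S a →
      realObjective g E lam S a - realObjective g E lam S z ≤ ρ →
      IsSweep (objective g E lam S) (feasibleSet S) a b →
      realObjective g E lam S b - realObjective g E lam S z ≤
        θ * (realObjective g E lam S a - realObjective g E lam S z) ∧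
      ‖b - a‖ ^ 2 ≤ M * (realObjective g E lam S a - realObjective g E lam S z) := by
  set f := realObjective g E lam S with hf
  set φ := finitePart g with hφ
  set K := bregmanSublevel g (E.mulVec z) ρ with hK
  have hKcpt : IsCompact K := isCompact_bregmanSublevel hg hz.2 ρ
  have hKcvx : Convex ℝ K := convex_bregmanSublevel hg _ ρ
  have hKsub : K ⊆ effDom g := bregmanSublevel_subset _ _ _
  have hzK : E.mulVec z ∈ K := mem_bregmanSublevel_self hz.2 hρ
  obtain ⟨c, hc, hstrong⟩ := exists_strong_convexity_of_isCompact hg.isOpen hg.contDiffOn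
    hg.hessian_pos hKcpt hKcvx hKsub
  obtain ⟨L, hL0, hL⟩ := exists_lipschitz_fderiv_of_isCompact hg.isOpen hg.contDiffOn
    hKcpt hKcvx hKsub
  obtain ⟨A, hA0, hA⟩ := exists_mulVec_norm_le E
  obtain ⟨C₁, C₂, hC₁, hC₂, herr⟩ := exists_error_bound hlam hz.1 hq
  -- The sum serves as an upper bound for the largest of the reciprocal decrease constants.
  set M := ∑ i, (c * ‖E.col i‖ ^ 2)⁻¹ with hM
  have hM0 : 0 ≤ M := Finset.sum_nonneg fun i _ => by positivity
  set B := ∑ i : Fin n, L * A * ‖E.col i‖ with hB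
  have hB0 : 0 ≤ B := Finset.sum_nonneg fun i _ => by positivity
  set D := 2 * (C₁ ^ 2 * ρ + C₂ ^ 2 / c) with hD
  have hD0 : 0 ≤ D := by positivity
  set W := B ^ 2 * D * M with hW
  have hW0 : 0 ≤ W := by positivity
  refine ⟨W / (1 + W), M, by positivity, by rw [div_lt_one (by positivity)]; linarith, hM0, ?_⟩
  intro a b ha hρa hsweep
  have hbadm := hsweep.isAdmissible hg.ne_bot ha
  obtain ⟨y, hy0, hyl, hstep⟩ := hsweep
  have hyadm : ∀ k, IsAdmissible g E S (y k) ∧ f (y k) ≤ f a := fun k => by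
    induction k using Fin.induction with
    | zero => rw [hy0]; exact ⟨ha, le_rfl⟩
    | succ i ih => exact ⟨(hstep i).isAdmissible hg.ne_bot ih.1,
        ((hstep i).realObjective_le hg.ne_bot ih.1).trans ih.2⟩
  have hyK : ∀ k, E.mulVec (y k) ∈ K := fun k =>
    mulVec_mem_bregmanSublevel hq (hyadm k).1.1 (hyadm k).1.2 (by linarith [(hyadm k).2])
  have hbK : E.mulVec b ∈ K := hyl ▸ hyK _
  have hcoord := sweep_coord_eq (fun i => (hstep i).1.2)
  have hbi : ∀ i : Fin n, y i.succ i = b i := fun i => by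
    rw [(hcoord i i.succ).2 (by simp), hyl]
  have hai : ∀ i : Fin n, y i.castSucc i = a i := fun i => by
    rw [(hcoord i i.castSucc).1 (by simp), hy0]
  have hvar : ∀ (i : Fin n) (s : ℝ), (i ∉ S → 0 ≤ s) →
      0 ≤ coordVariation g E lam S (y i.succ) i s := fun i s hs =>
    (hstep i).coordVariation_nonneg hg hlam (hyadm _).1 hs
  have hdec : ∀ i : Fin n, c * ‖E.col i‖ ^ 2 * (b i - a i) ^ 2 ≤
      f (y i.castSucc) - f (y i.succ) := fun i => by
    have h1 := realObjective_add_le_of_coordVariation_nonneg (lam := lam) (S := S) hstrong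
      (hyK i.castSucc) (hyK i.succ) (fun j hj => ((hstep i).1.2 j hj).symm)
      (hvar i _ ((hyadm _).1.1 i))
    rw [hbi, hai] at h1
    have h2 : (a i - b i) ^ 2 = (b i - a i) ^ 2 := by ring
    rw [h2] at h1
    linarith
  have hdecnn : ∀ i : Fin n, 0 ≤ f (y i.castSucc) - f (y i.succ) := fun i =>
    le_trans (by positivity) (hdec i)
  have htele : ∑ i : Fin n, (f (y i.castSucc) - f (y i.succ)) = f a - f b := by
    rw [sum_sub_succ_castSucc (fun k => f (y k)), hy0, hyl]
  have hab : 0 ≤ f a - f b := htele ▸ Finset.sum_nonneg fun i _ => hdecnn i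
  have hmove : ‖b - a‖ ^ 2 ≤ M * (f a - f b) := by
    have h1 : ‖b - a‖ ≤ √(M * (f a - f b)) := by
      refine (pi_norm_le_iff_of_nonneg (Real.sqrt_nonneg _)).2 fun i => ?_
      rw [Real.norm_eq_abs]
      refine Real.abs_le_sqrt ?_
      have h2 : c * ‖E.col i‖ ^ 2 * (b i - a i) ^ 2 ≤ f a - f b :=
        (hdec i).trans (htele ▸ Finset.single_le_sum (fun j _ => hdecnn j) (Finset.mem_univ i))
      have h3 : 0 < c * ‖E.col i‖ ^ 2 := mul_pos hc (pow_pos (norm_col_pos (hE i)) 2)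
      have h4 : (b i - a i) ^ 2 ≤ (c * ‖E.col i‖ ^ 2)⁻¹ * (f a - f b) := by
        rwa [le_inv_mul_iff₀ h3]
      refine h4.trans (mul_le_mul_of_nonneg_right ?_ hab)
      exact Finset.single_le_sum (f := fun i => (c * ‖E.col i‖ ^ 2)⁻¹)
        (fun j _ => by positivity) (Finset.mem_univ i)
    calc ‖b - a‖ ^ 2 ≤ √(M * (f a - f b)) ^ 2 := by gcongr
      _ = _ := Real.sq_sqrt (mul_nonneg hM0 hab)
  obtain ⟨u, huX, huE, hu0, hbu⟩ := herr b hbadm.1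
  have hgapu : f b - f z ≤ B * ‖b - a‖ * ‖b - u‖ := by
    have := sweep_gap_le hL0 hL hA0 hA (fun s hs t ht => hg.tangent_le (hKsub hs) (hKsub ht))
      hzK hyK (fun i => (hstep i).1.2) hvar huX huE hu0
    rwa [hy0, hyl] at this
  have hBreg : c * ‖E.mulVec b - E.mulVec z‖ ^ 2 ≤
      f b - f z - ∑ i, coordVariation g E lam S z i (b i) := by
    have h1 := hstrong _ hzK _ hbK
    have h2 := realObjective_sub g E lam S b z
    linarith
  exact ⟨contraction_of_bounds hc hM0 hB0 (norm_nonneg _) (norm_nonneg _)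
      (Finset.sum_nonneg fun i _ => hq i _ (hbadm.1 i)) hab hρa hgapu hbu hBreg hmove,
    hmove.trans (mul_le_mul_of_nonneg_left (by
      have : 0 ≤ ∑ i, coordVariation g E lam S z i (b i) :=
        Finset.sum_nonneg fun i _ => hq i _ (hbadm.1 i)
      have : 0 ≤ c * ‖E.mulVec b - E.mulVec z‖ ^ 2 := by positivity
      linarith) hM0)⟩

end Sweep

/-! ### Linear convergence of the iterates -/

section Convergence

variable {m n : ℕ} {g : (Fin m → ℝ) → EReal} {E : Matrix (Fin m) (Fin n) ℝ} {lam : ℝ}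
  {S : Finset (Fin n)}

theorem tendsto_of_isCCMIterates (hg : IsSmoothConvexBarrier g) (hlam : 0 ≤ lam)
    (hE : ∀ j, ∃ i, E i j ≠ 0) {z : Fin n → ℝ} (hz : IsAdmissible g E S z)
    (hzmin : ∀ y ∈ feasibleSet S, objective g E lam S z ≤ objective g E lam S y)
    (hq : ∀ i s, (i ∉ S → 0 ≤ s) → 0 ≤ coordVariation g E lam S z i s) {x₀ : Fin n → ℝ}
    (hx₀ : IsAdmissible g E S x₀) {x : ℕ → (Fin n → ℝ)}
    (hx : IsCCMIterates (objective g E lam S) (feasibleSet S) x₀ x) :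
    ∃ xstar ∈ feasibleSet S, Tendsto x atTop (𝓝 xstar) ∧
      ∀ y ∈ feasibleSet S, objective g E lam S xstar ≤ objective g E lam S y := by
  have hadm : ∀ r, IsAdmissible g E S (x r) := fun r => by
    induction r with
    | zero => exact hx.1 ▸ hx₀
    | succ r ih => exact (hx.2 r).isAdmissible hg.ne_bot ih
  have hgap0 : ∀ r, 0 ≤ realObjective g E lam S (x r) - realObjective g E lam S z := fun r => by
    have := hzmin _ (hadm r).1
    rw [objective_eq_coe hg.ne_bot E lam S hz.2, objective_eq_coe hg.ne_bot E lam S (hadm r).2,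
      EReal.coe_le_coe_iff] at this
    linarith
  set ρ := realObjective g E lam S (x 0) - realObjective g E lam S z with hρ
  have hρ0 : 0 ≤ ρ := hgap0 0
  obtain ⟨θ, M, hθ0, hθ1, hM, hcontr⟩ := exists_sweep_contraction hg hlam hE hz hq hρ0
  -- The bound by `ρ` is carried along because the contraction constants are valid only for gaps up
  -- to `ρ`.
  have hgeom : ∀ r, realObjective g E lam S (x r) - realObjective g E lam S z ≤ ρ * θ ^ r ∧
      realObjective g E lam S (x r) - realObjective g E lam S z ≤ ρ := fun r => by
    have hle : ∀ k : ℕ, ρ * θ ^ k ≤ ρ := fun k =>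
      mul_le_of_le_one_right hρ0 (pow_le_one₀ hθ0 hθ1.le)
    induction r with
    | zero => simp [← hρ]
    | succ r ih =>
      have h1 := (hcontr _ _ (hadm r) ih.2 (hx.2 r)).1
      have h2 : realObjective g E lam S (x (r + 1)) - realObjective g E lam S z ≤
          ρ * θ ^ (r + 1) :=
        h1.trans ((mul_le_mul_of_nonneg_left ih.1 hθ0).trans_eq (by ring))
      exact ⟨h2, h2.trans (hle _)⟩
  -- Squared steps are bounded by the gap, so the steps decay with ratio `√θ < 1` and are summable.
  have hdist : ∀ r, dist (x r) (x (r + 1)) ≤ √(M * ρ) * √θ ^ r := fun r => by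
    have h1 := (hcontr _ _ (hadm r) (hgeom r).2 (hx.2 r)).2
    have h2 : ‖x (r + 1) - x r‖ ^ 2 ≤ M * ρ * θ ^ r :=
      h1.trans ((mul_le_mul_of_nonneg_left (hgeom r).1 hM).trans_eq (by ring))
    rw [dist_comm, dist_eq_norm]
    refine (sq_le_sq₀ (norm_nonneg _) (by positivity)).1 (h2.trans_eq ?_)
    rw [mul_pow, Real.sq_sqrt (mul_nonneg hM hρ0), pow_right_comm, Real.sq_sqrt hθ0]
  have hcauchy : CauchySeq x := cauchySeq_of_le_geometric (√θ) (√(M * ρ))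
    ((Real.sqrt_lt' one_pos).2 (by simpa using hθ1)) hdist
  obtain ⟨xstar, hlim⟩ := cauchySeq_tendsto_of_complete hcauchy
  refine ⟨xstar, (isClosed_feasibleSet S).mem_of_tendsto hlim
    (Eventually.of_forall fun r => (hadm r).1), hlim, ?_⟩
  have h1 : Tendsto (fun r => objective g E lam S (x r)) atTop (𝓝 (objective g E lam S xstar)) :=
    ((continuous_objective hg.continuous E lam S).tendsto xstar).comp hlim
  have h2 : Tendsto (fun r => realObjective g E lam S (x r)) atTop
      (𝓝 (realObjective g E lam S z)) := by
    have h3 : Tendsto (fun r : ℕ => ρ * θ ^ r) atTop (𝓝 0) := by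
      simpa using (tendsto_pow_atTop_nhds_zero_of_lt_one hθ0 hθ1).const_mul ρ
    have h4 := (squeeze_zero hgap0 (fun r => (hgeom r).1) h3).add_const
      (realObjective g E lam S z)
    simpa using h4
  have h5 : Tendsto (fun r => objective g E lam S (x r)) atTop (𝓝 (objective g E lam S z)) := by
    simp only [fun r => objective_eq_coe hg.ne_bot E lam S (hadm r).2,
      objective_eq_coe hg.ne_bot E lam S hz.2]
    exact (continuous_coe_real_ereal.tendsto _).comp h2
  rw [tendsto_nhds_unique h1 h5]
  exact hzmin

end Convergence

theorem theorem2p1 {m n : ℕ} (g : (Fin m → ℝ) → EReal) (E : Matrix (Fin m) (Fin n) ℝ)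
    (lam : ℝ) (S : Finset (Fin n))
    -- `g` is a convex function with values in `ℝ ∪ {∞}`
    (hg_bot : ∀ t, g t ≠ ⊥)
    (hg_convex : ConvexOn ℝ (effDom g) (finitePart g))
    (hlam : 0 < lam)
    -- no column of `E` is zero
    (hE : ∀ j, ∃ i, E i j ≠ 0)
    -- (A1)
    (hA1 : (domInterior g).Nonempty)
    -- (A2)
    (hA2_convex : StrictConvexOn ℝ (domInterior g) (finitePart g))
    (hA2_smooth : ContDiffOn ℝ 2 (finitePart g) (domInterior g))
    -- (A3)
    (hA3 : (∀ b ∈ frontier (domInterior g), Tendsto g (𝓝[domInterior g] b) (𝓝 ⊤)) ∨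
      (S = Finset.univ ∧ (∀ t, 0 ≤ g t) ∧ domInterior g = Set.univ))
    -- (A4)
    (hA4 : ∀ t ∈ domInterior g, ∀ v : Fin m → ℝ, v ≠ 0 → 0 < hessianForm g t v)
    -- (A5)
    (hA5 : ∃ z ∈ feasibleSet S, ∀ y ∈ feasibleSet S,
      objective g E lam S z ≤ objective g E lam S y)
    -- the starting point
    (x₀ : Fin n → ℝ) (hx₀ : x₀ ∈ feasibleSet S) (hx₀_fin : objective g E lam S x₀ < ⊤) :
    (∃! x : ℕ → (Fin n → ℝ), IsCCMIterates (objective g E lam S) (feasibleSet S) x₀ x) ∧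
    ∀ x : ℕ → (Fin n → ℝ), IsCCMIterates (objective g E lam S) (feasibleSet S) x₀ x →
      ∃ xstar ∈ feasibleSet S, Tendsto x atTop (𝓝 xstar) ∧
        ∀ y ∈ feasibleSet S, objective g E lam S xstar ≤ objective g E lam S y := by
  -- In the second alternative of (A3) the boundary is empty, so both alternatives reduce to
  -- blow-up.
  have hblow : ∀ b ∈ frontier (domInterior g), Tendsto g (𝓝[domInterior g] b) (𝓝 ⊤) := by
    rcases hA3 with h | ⟨-, -, h⟩
    · exact h
    · simp [h]
  have hg : IsSmoothConvexBarrier g :=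
    isSmoothConvexBarrier hg_bot hg_convex hA1 hA2_smooth hA4 hblow
  obtain ⟨z, hzX, hzmin⟩ := hA5
  have hzE : E.mulVec z ∈ effDom g := mulVec_mem_effDom ((hzmin x₀ hx₀).trans_lt hx₀_fin)
  have hq : ∀ i s, (i ∉ S → 0 ≤ s) → 0 ≤ coordVariation g E lam S z i s := fun i s hs =>
    coordVariation_nonneg hg hlam.le hzX hzE (fun y hy => hzmin y hy.1) hs
  have hx₀' : IsAdmissible g E S x₀ := ⟨hx₀, mulVec_mem_effDom hx₀_fin⟩
  exact ⟨existsUnique_isCCMIterates hg hlam.le hE hzE hq hx₀',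
    fun x hx => tendsto_of_isCCMIterates hg hlam.le hE ⟨hzX, hzE⟩ hzmin hq hx₀' hx⟩
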